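/- Let $M$ be a connected oriented smooth surface without boundary and let $g,\hat g$ be smooth Riemannian metrics on $M$. Let $SM=\{(x,v)\in TM: g(v,v)=1\}$ and $\widehat{SM}=\{(x,v)\in TM: \hat g(v,v)=1\}$ be the unit tangent bundles. Let $X$ be the geodesic vector field of $g$ on $SM$, let $V$ be the infinitesimal generator of the counter-clockwise rotation of the fibres of $SM$, and let $J$ be the rotation of tangent vectors by $\pi/2$ determined by $g$ and the orientation; denote by $\hat X,\hat V$ the corresponding vector fields on $\widehat{SM}$. For $\lambda\in C^\infty(SM)$ and $\hat\lambda\in C^\infty(\widehat{SM})$ put $F=X+\lambda V$ and $\hat F=\hat X+\hat\lambda\hat V$; the (local) flow of $F$ is called the thermostat of $(g,\lambda)$, and the projections to $M$ of its orbits are called its geodesics; likewise for $(\hat g,\hat\lambda)$. Two thermostats have the same unparametrised geodesics if every geodesic of either one becomes a geodesic of the other after an orientation preserving smooth reparametrisation. Define $\ell:SM\to\widehat{SM}$ by $\ell(x,v)=\bigl(x,v/\sqrt{\hat g(v,v)}\bigr)$ and functions on $SM$ by $$p(x,v)=\hat g(v,v),\qquad r(x,v)=\hat g(v,Jv),\qquad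 q(x,v)=\hat g(Jv,Jv).$$ If the thermostats of $(g,\lambda)$ and $(\hat g,\hat\lambda)$ have the same unparametrised geodesics, then on $SM$ $$\sqrt{p}\,\bigl(\hat V\hat\lambda\circ\ell\bigr)=F\log\left(\frac{pq-r^2}{p^{3/2}}\right)+V\lambda .$$ In particular, if the metrics $g$ and $\hat g$ have the same unparametrised geodesics (the case $\lambda=0$, $\hat\lambda=0$), then $p/(pq-r^2)^{2/3}$ is a first integral of the geodesic flow of $g$, that is, it is constant along every orbit of the flow. -/

import Mathlib

open scoped Manifold ContDiff Topology Bundle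

noncomputable section

namespace Thermostat

/-- The model space of a surface. -/
abbrev Plane : Type := EuclideanSpace ℝ (Fin 2)

section Surface

variable (M : Type*) [TopologicalSpace M] [ChartedSpace Plane M] [IsManifold (𝓡 2) ∞ M]

/-- The tangent bundle of the surface `M`, as a smooth manifold modelled on `Plane × Plane`. -/
abbrev TM : Type _ := TangentBundle (𝓡 2) M

/-- A smooth Riemannian metric on the surface `M`. -/
abbrev RiemMetric : Type _ :=
  Bundle.ContMDiffRiemannianMetric (𝓡 2) ∞ Plane (fun x : M => TangentSpace (𝓡 2) x)

/-- An orientation of the surface `M`: an orientation of every tangent plane which is locally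
constant when the tangent planes are identified with `Plane` by a chart. -/
structure SurfaceOrientation where
  /-- the orientation of the tangent plane at `x` -/
  at' (x : M) : Orientation ℝ (TangentSpace (𝓡 2) x) (Fin 2)
  locallyConstant (x₀ : M) : ∃ o₀ : Orientation ℝ Plane (Fin 2), ∀ᶠ x in 𝓝 x₀,
    ∃ hx : x ∈ (trivializationAt Plane (TangentSpace (𝓡 2)) x₀).baseSet,
      Orientation.map (Fin 2)
        ((trivializationAt Plane (TangentSpace (𝓡 2)) x₀).linearEquivAt ℝ x hx) (at' x) = o₀

variable {M}

instance finrankTangent (x : M) : Fact (Module.finrank ℝ (TangentSpace (𝓡 2) x) = 2) :=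
  ⟨finrank_euclideanSpace_fin⟩

/-- The complex structure `J` of an oriented Riemannian surface: rotation of tangent vectors by
`π / 2`, counter-clockwise with respect to `g` and the orientation. -/
def rot (g : RiemMetric M) (o : SurfaceOrientation M) (x : M) (v : TangentSpace (𝓡 2) x) :
    TangentSpace (𝓡 2) x :=
  letI : Bundle.RiemannianBundle (fun x : M => TangentSpace (𝓡 2) x) := ⟨g.toRiemannianMetric⟩
  (o.at' x).rightAngleRotation v

/-! ### The unit tangent bundle -/

/-- The squared length `g (v, v)` of a tangent vector. -/
def normSq (g : RiemMetric M) (u : TM M) : ℝ := g.inner u.1 u.2 u.2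

/-- The unit tangent bundle `SM` of `g`. -/
def UnitTangent (g : RiemMetric M) : Type _ := {u : TM M // normSq g u = 1}

lemma UnitTangent.ne_zero {g : RiemMetric M} (u : UnitTangent g) : u.1.2 ≠ 0 := by
  intro h
  have h1 := u.2
  rw [normSq, h] at h1
  simp at h1

/-- The unit vector `v / √(g (v, v))` in the direction of a nonzero tangent vector. -/
def normalize (g : RiemMetric M) (u : TM M) (hu : u.2 ≠ 0) : UnitTangent g :=
  ⟨⟨u.1, (Real.sqrt (normSq g u))⁻¹ • u.2⟩, by
    have hpos : 0 < normSq g u := g.pos u.1 u.2 hu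
    change g.inner u.1 ((Real.sqrt (normSq g u))⁻¹ • u.2) ((Real.sqrt (normSq g u))⁻¹ • u.2) = 1
    rw [map_smul, map_smul, smul_apply, smul_eq_mul, smul_eq_mul]
    change (Real.sqrt (normSq g u))⁻¹ * ((Real.sqrt (normSq g u))⁻¹ * normSq g u) = 1
    have hs : Real.sqrt (normSq g u) ^ 2 = normSq g u := Real.sq_sqrt hpos.le
    have hne : Real.sqrt (normSq g u) ≠ 0 := (Real.sqrt_pos.2 hpos).ne'
    generalize Real.sqrt (normSq g u) = s at hs hne
    rw [← hs]
    field_simp⟩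

open Classical in
/-- The extension of a function on `SM` to all of `TM` which is constant along the open rays in
each tangent plane (and, by convention, zero on the zero section). -/
def extend (g : RiemMetric M) (f : UnitTangent g → ℝ) (u : TM M) : ℝ :=
  if hu : u.2 ≠ 0 then f (normalize g u hu) else 0

/-- Smoothness of a function on `SM`. The map `normalize` is a smooth retraction of the complement
of the zero section onto `SM`, so a function on the submanifold `SM` is smooth if and only if its
extension along rays is smooth off the zero section. -/
def SmoothOnSM (g : RiemMetric M) (f : UnitTangent g → ℝ) : Prop :=
  ContMDiffOn (𝓡 2).tangent 𝓘(ℝ, ℝ) ∞ (extend g f) {u : TM M | u.2 ≠ 0}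

/-- The derivative of a function on `SM` at `u` in the direction of a vector `ξ` tangent to `SM`;
for such `ξ` the choice of the extension of the function to a neighbourhood is irrelevant. -/
def derivSM (g : RiemMetric M) (f : UnitTangent g → ℝ) (u : UnitTangent g)
    (ξ : TangentSpace (𝓡 2).tangent u.1) : ℝ :=
  mfderiv (𝓡 2).tangent 𝓘(ℝ, ℝ) (extend g f) u.1 ξ

/-! ### The geodesic vector field, the vertical vector field and thermostats -/

/-- The metric `g` in the chart at `x₀`: the pullback of `g` to the plane by the inverse chart. -/
def metricInChart (g : RiemMetric M) (x₀ : M) (y : Plane) : Plane →L[ℝ] Plane →L[ℝ] ℝ :=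
  let x : M := (extChartAt (𝓡 2) x₀).symm y
  let T : Plane →L[ℝ] TangentSpace (𝓡 2) x :=
    (trivializationAt Plane (TangentSpace (𝓡 2)) x₀).symmL ℝ x
  ContinuousLinearMap.precomp ℝ T ∘L g.inner x ∘L T

/-- The Christoffel symbols of the first kind of the Levi-Civita connection, in the chart at `x₀`:
`½ (∂ₐ g(b, c) + ∂_b g(a, c) - ∂_c g(a, b))`. -/
def christoffelLower (g : RiemMetric M) (x₀ : M) (y a b c : Plane) : ℝ :=
  (1 / 2) * (fderiv ℝ (metricInChart g x₀) y a b c + fderiv ℝ (metricInChart g x₀) y b a c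
    - fderiv ℝ (metricInChart g x₀) y c a b)

/-- The Gram matrix `(g_{ij})` of `g` in the chart at `x₀`. -/
def gram (g : RiemMetric M) (x₀ : M) (y : Plane) : Matrix (Fin 2) (Fin 2) ℝ :=
  Matrix.of fun i j =>
    metricInChart g x₀ y (EuclideanSpace.single i 1) (EuclideanSpace.single j 1)

/-- The Christoffel symbols (of the second kind) `Γ(a, b)` of the Levi-Civita connection of `g`,
in the chart at `x₀`. -/
def christoffel (g : RiemMetric M) (x₀ : M) (y a b : Plane) : Plane :=
  WithLp.toLp 2 fun k =>
    ∑ l, (gram g x₀ y)⁻¹ k l * christoffelLower g x₀ y a b (EuclideanSpace.single l 1)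

/-- The geodesic vector field `X` of `g`: in a chart, `X (x, v) = (v, -Γ(v, v))`. The tangent space
of `TM` at `u` is identified with `Plane × Plane` by the chart of `TM` that is induced by the
chart of `M` at the base point of `u`. -/
def geodesicField (g : RiemMetric M) (u : TM M) : TangentSpace (𝓡 2).tangent u :=
  ((u.2, -christoffel g u.1 (extChartAt (𝓡 2) u.1 u.1) u.2 u.2) : Plane × Plane)

/-- The vertical vector field `V`, the generator of the rotations of the fibres: in a chart,
`V (x, v) = (0, J v)`. -/
def verticalField (g : RiemMetric M) (o : SurfaceOrientation M) (u : TM M) :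
    TangentSpace (𝓡 2).tangent u :=
  (((0 : Plane), (rot g o u.1 u.2 : Plane)) : Plane × Plane)

/-- The generator `F = X + lam V` of the thermostat of the pair `(g, lam)`. -/
def thermostatField (g : RiemMetric M) (o : SurfaceOrientation M) (lam : UnitTangent g → ℝ)
    (u : TM M) : TangentSpace (𝓡 2).tangent u :=
  geodesicField g u + extend g lam u • verticalField g o u

/-- `δ : s → SM` is an orbit (segment) of the thermostat of `(g, lam)`. -/
def IsOrbit (g : RiemMetric M) (o : SurfaceOrientation M) (lam : UnitTangent g → ℝ)
    (s : Set ℝ) (δ : ℝ → TM M) : Prop :=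
  IsMIntegralCurveOn δ (thermostatField g o lam) s ∧ ∀ t ∈ s, normSq g (δ t) = 1

/-- `γ : s → M` is a (parametrised) geodesic of the thermostat of `(g, lam)`: the projection of an
orbit. -/
def IsGeodesic (g : RiemMetric M) (o : SurfaceOrientation M) (lam : UnitTangent g → ℝ)
    (s : Set ℝ) (γ : ℝ → M) : Prop :=
  ∃ δ : ℝ → TM M, IsOrbit g o lam s δ ∧ ∀ t ∈ s, (δ t).1 = γ t

/-- `s` is an open interval (possibly unbounded or empty). -/
def IsOpenInterval (s : Set ℝ) : Prop := IsOpen s ∧ s.OrdConnected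

/-- `φ : s' → s` is an orientation preserving reparametrisation: a smooth map with positive
derivative from the open interval `s'` onto `s`. -/
def IsReparametrisation (φ : ℝ → ℝ) (s' s : Set ℝ) : Prop :=
  IsOpenInterval s' ∧ ContDiffOn ℝ ∞ φ s' ∧ (∀ t ∈ s', 0 < deriv φ t) ∧ φ '' s' = s

/-- Every geodesic of the thermostat of `(g, lam)` becomes a geodesic of the thermostat of
`(g', lam')` after an orientation preserving reparametrisation. -/
def GeodesicsReparametriseTo (o : SurfaceOrientation M)
    (g : RiemMetric M) (lam : UnitTangent g → ℝ) (g' : RiemMetric M) (lam' : UnitTangent g' → ℝ) : Prop :=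
  ∀ (s : Set ℝ) (γ : ℝ → M), IsOpenInterval s → IsGeodesic g o lam s γ →
    ∃ (s' : Set ℝ) (φ : ℝ → ℝ), IsReparametrisation φ s' s ∧ IsGeodesic g' o lam' s' (γ ∘ φ)

/-- The thermostats of `(g, lam)` and `(g', lam')` have the same unparametrised geodesics. -/
def SameUnparametrisedGeodesics (o : SurfaceOrientation M)
    (g : RiemMetric M) (lam : UnitTangent g → ℝ) (g' : RiemMetric M) (lam' : UnitTangent g' → ℝ) : Prop :=
  GeodesicsReparametriseTo o g lam g' lam' ∧ GeodesicsReparametriseTo o g' lam' g lam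

/-- `f` is a first integral of the geodesic flow of `g`: it is constant along every orbit. -/
def IsFirstIntegral (g : RiemMetric M) (o : SurfaceOrientation M) (f : UnitTangent g → ℝ) : Prop :=
  ∀ (s : Set ℝ) (δ : ℝ → TM M), IsOpenInterval s → ∀ hδ : IsOrbit g o 0 s δ,
    ∀ (t₁ t₂ : ℝ) (h₁ : t₁ ∈ s) (h₂ : t₂ ∈ s),
      f ⟨δ t₁, hδ.2 t₁ h₁⟩ = f ⟨δ t₂, hδ.2 t₂ h₂⟩

/-! ### Two metrics -/

/-- The scaling map `ℓ : SM → SM'`, `(x, v) ↦ (x, v / √(g' (v, v)))`. -/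
def scaling (g g' : RiemMetric M) (u : UnitTangent g) : UnitTangent g' :=
  normalize g' u.1 u.ne_zero

/-- `p (x, v) = g' (v, v)` -/
def pFun (g g' : RiemMetric M) (u : UnitTangent g) : ℝ := g'.inner u.1.1 u.1.2 u.1.2

/-- `r (x, v) = g' (v, J v)`, where `J` is the complex structure of `g` -/
def rFun (g g' : RiemMetric M) (o : SurfaceOrientation M) (u : UnitTangent g) : ℝ :=
  g'.inner u.1.1 u.1.2 (rot g o u.1.1 u.1.2)

/-- `q (x, v) = g' (J v, J v)`, where `J` is the complex structure of `g` -/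
def qFun (g g' : RiemMetric M) (o : SurfaceOrientation M) (u : UnitTangent g) : ℝ :=
  g'.inner u.1.1 (rot g o u.1.1 u.1.2) (rot g o u.1.1 u.1.2)

end Surface

end Thermostat

end

open Thermostat

/-!
The proof compares the two families of geodesics to second order at a point and then differentiates
the resulting identity along a fibre.

Fix a unit vector `v` of `g` at `x`, write `G`, `G'` for the metrics in the chart at `x`, `Γ`, `Γ'`
for their Christoffel symbols, and `n = J v`. The symbols obey the usual transformation law
(`fderiv_symbol`), so the thermostat field, whose definition uses a different chart at each point,
is a `C¹` vector field off the zero section of `TM` (`contMDiffAt_thermostatField`). It annihilates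
`g (v, v)` (`mfderiv_normSq_thermostatField`), hence an orbit of unit vectors passes through `v`
(`exists_isOrbit`). Its projection to `M` can be reparametrised to a geodesic of the second
thermostat. Comparing the first and second derivatives of both curves in the chart gives
(`normal_acceleration_eq`, `normal_acceleration_circle`)
`G (n, (Γ' - Γ) (v, v)) + λ = κ p √p (λ' ∘ ℓ)`, where `κ` is the quotient of the area densities of
`g` and `g'`, so that `κ p = G (J v, J' v)` and `κ` is constant on the fibre.

This holds for all unit vectors `cos θ v + sin θ n` of the fibre. Its derivative at `θ = 0` is
`normal_acceleration_deriv`. On the other hand `p q - r ^ 2` is the quotient of the Gram determinants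
of `g'` and `g` (`density_eq`), and the compatibility of each Levi-Civita connection with its metric
expresses `F log ((p q - r ^ 2) / p ^ (3 / 2))` through the components of `Γ' - Γ` in the basis `v, n`
(`logDensity_algebra`, `derivSM_logDensity`). The two formulas combine to the claimed identity
(`derivSM_identity`). If `λ = λ' = 0`, it says that the geodesic field annihilates the logarithm of
`(p q - r ^ 2) / p ^ (3 / 2)`, and `p / (p q - r ^ 2) ^ (2 / 3)` is a function of that logarithm.
-/

open scoped Manifold ContDiff Topology Bundle

noncomputable section

namespace Thermostat

set_option linter.unusedSectionVars false

/-- The space of bilinear forms on the plane. -/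
abbrev BilinForm : Type := Plane →L[ℝ] Plane →L[ℝ] ℝ

/- Without these instances, elaboration of derivatives of maps into `BilinForm` fails below. -/
instance : NormedAddCommGroup BilinForm := ContinuousLinearMap.toNormedAddCommGroup
instance : NormedSpace ℝ BilinForm := ContinuousLinearMap.toNormedSpace

/-! ### Symmetric bilinear forms on the plane -/

/-- The standard area form of the plane. -/
def wedge (a b : Plane) : ℝ := a 0 * b 1 - a 1 * b 0

/-- The Gram determinant of two vectors with respect to a bilinear form. -/
def gramDet (B : BilinForm) (a b : Plane) : ℝ := B a a * B b b - B a b ^ 2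

/-- The standard basis vectors of the plane. -/
abbrev stdVec (i : Fin 2) : Plane := EuclideanSpace.single i 1

lemma plane_eq (a : Plane) : a = a 0 • stdVec 0 + a 1 • stdVec 1 := by
  ext i
  fin_cases i <;> simp

lemma bilin_expand (B : BilinForm) (a b : Plane) :
    B a b = a 0 * b 0 * B (stdVec 0) (stdVec 0) + a 0 * b 1 * B (stdVec 0) (stdVec 1)
      + a 1 * b 0 * B (stdVec 1) (stdVec 0) + a 1 * b 1 * B (stdVec 1) (stdVec 1) := by
  conv_lhs => rw [plane_eq a, plane_eq b]
  simp only [map_add, map_smul, add_apply, smul_apply, smul_eq_mul]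
  ring

lemma gramDet_eq {B : BilinForm} (hs : ∀ a b, B a b = B b a) (a b : Plane) :
    gramDet B a b = wedge a b ^ 2 * gramDet B (stdVec 0) (stdVec 1) := by
  unfold gramDet wedge
  rw [bilin_expand B a a, bilin_expand B b b, bilin_expand B a b, hs (stdVec 1) (stdVec 0)]
  ring

lemma gramDet_std_pos {B : BilinForm} (hs : ∀ a b, B a b = B b a)
    (hp : ∀ a, a ≠ 0 → 0 < B a a) : 0 < gramDet B (stdVec 0) (stdVec 1) := by
  have h0 : 0 < B (stdVec 0) (stdVec 0) := hp _ (by simp)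
  set w : Plane := B (stdVec 0) (stdVec 0) • stdVec 1 - B (stdVec 0) (stdVec 1) • stdVec 0 with hw
  have hw0 : w ≠ 0 := fun h => by
    have := congrArg (fun z : Plane => z 1) h
    simp [hw, h0.ne'] at this
  have h1 := hp w hw0
  have h2 : B w w = B (stdVec 0) (stdVec 0) * gramDet B (stdVec 0) (stdVec 1) := by
    simp only [hw, map_sub, map_smul, sub_apply, smul_apply, smul_eq_mul, gramDet,
      hs (stdVec 1) (stdVec 0)]
    ring
  rw [h2] at h1
  exact (pos_iff_pos_of_mul_pos h1).1 h0

lemma gramDet_pos_of_wedge {B : BilinForm} (hs : ∀ a b, B a b = B b a)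
    (hp : ∀ a, a ≠ 0 → 0 < B a a) {v n : Plane} (hvn : wedge v n ≠ 0) : 0 < gramDet B v n := by
  rw [gramDet_eq hs]
  exact mul_pos (by positivity) (gramDet_std_pos hs hp)

lemma wedge_ne_zero_of_orthonormal {B : BilinForm} (hs : ∀ a b, B a b = B b a) {v n : Plane}
    (hv : B v v = 1) (hvn : B v n = 0) (hn : B n n = 1) : wedge v n ≠ 0 := by
  intro h
  have hG := gramDet_eq hs v n
  rw [h, gramDet, hv, hvn, hn] at hG
  norm_num at hG

/-- A vector is determined by its pairings with a positive definite form. -/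
lemma eq_of_forall_pairing {B : BilinForm} (hp : ∀ a, a ≠ 0 → 0 < B a a)
    {a b : Plane} (h : ∀ c, B a c = B b c) : a = b := by
  by_contra hne
  have := hp (a - b) (sub_ne_zero.2 hne)
  rw [map_sub B, sub_apply, h (a - b), sub_self] at this
  exact lt_irrefl _ this

/-- Expansion of a vector in an orthonormal basis. -/
lemma orthonormal_expand {B : BilinForm} (hs : ∀ a b, B a b = B b a)
    {v n : Plane} (hv : B v v = 1) (hvn : B v n = 0)
    (hn : B n n = 1) (w : Plane) : w = B v w • v + B n w • n := by
  have hW := wedge_ne_zero_of_orthonormal hs hv hvn hn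
  have hspan : w = (wedge w n / wedge v n) • v + (wedge v w / wedge v n) • n := by
    ext i
    fin_cases i <;> simp <;> field_simp <;> simp only [wedge] <;> ring
  generalize wedge w n / wedge v n = s, wedge v w / wedge v n = t at hspan
  have h1 : B v w = s := by rw [hspan]; simp [hv, hvn]
  have h2 : B n w = t := by rw [hspan]; simp [hn, hvn, hs n v]
  rw [h1, h2, ← hspan]

/-! ### Christoffel symbols in a coordinate plane -/

/-- The Gram matrix of a bilinear form in the standard basis. -/
def gramMatrix (B : BilinForm) : Matrix (Fin 2) (Fin 2) ℝ :=
  Matrix.of fun i j => B (stdVec i) (stdVec j)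

lemma det_gramMatrix {B : BilinForm} (hs : ∀ a b, B a b = B b a) :
    (gramMatrix B).det = gramDet B (stdVec 0) (stdVec 1) := by
  simp [Matrix.det_fin_two, gramMatrix, gramDet, hs (stdVec 1) (stdVec 0), sq]

/-- The Christoffel symbols of the first kind of a field of bilinear forms on the plane. -/
def lowerSymbol (G : Plane → BilinForm) (y a b c : Plane) : ℝ :=
  (1 / 2) * (fderiv ℝ G y a b c + fderiv ℝ G y b a c - fderiv ℝ G y c a b)

/-- The Christoffel symbols of the second kind of a field of bilinear forms on the plane. -/
def symbol (G : Plane → BilinForm) (y a b : Plane) : Plane :=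
  WithLp.toLp 2 fun k => ∑ l, (gramMatrix (G y))⁻¹ k l * lowerSymbol G y a b (stdVec l)

lemma lowerSymbol_expand (G : Plane → BilinForm) (y a b c : Plane) :
    lowerSymbol G y a b c
      = c 0 * lowerSymbol G y a b (stdVec 0) + c 1 * lowerSymbol G y a b (stdVec 1) := by
  unfold lowerSymbol
  conv_lhs => rw [plane_eq c]
  simp only [map_add, map_smul, add_apply, smul_apply, smul_eq_mul]
  ring

/-- The defining property of the Christoffel symbols of the second kind. -/
lemma inner_symbol {G : Plane → BilinForm} {y : Plane}
    (hs : ∀ a b, G y a b = G y b a) (hp : ∀ a, a ≠ 0 → 0 < G y a a) (a b c : Plane) :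
    G y (symbol G y a b) c = lowerSymbol G y a b c := by
  have hdet : IsUnit (gramMatrix (G y)).det := by
    rw [det_gramMatrix hs]
    exact (gramDet_std_pos hs hp).ne'.isUnit
  have hmul : gramMatrix (G y) * (gramMatrix (G y))⁻¹ = 1 := Matrix.mul_nonsing_inv _ hdet
  have key : ∀ i, G y (symbol G y a b) (stdVec i) = lowerSymbol G y a b (stdVec i) := by
    intro i
    have h1 : G y (symbol G y a b) (stdVec i)
        = ∑ k, gramMatrix (G y) i k * symbol G y a b k := by
      conv_lhs => rw [plane_eq (symbol G y a b)]
      simp only [map_add, map_smul, add_apply, smul_apply, smul_eq_mul, Fin.sum_univ_two,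
        gramMatrix, Matrix.of_apply]
      rw [hs (stdVec 0), hs (stdVec 1)]
      ring
    have h2 : (gramMatrix (G y)).mulVec ((gramMatrix (G y))⁻¹.mulVec
        (fun l => lowerSymbol G y a b (stdVec l))) i = lowerSymbol G y a b (stdVec i) := by
      rw [Matrix.mulVec_mulVec, hmul, Matrix.one_mulVec]
    rw [h1, ← h2]
    rfl
  rw [lowerSymbol_expand, ← key 0, ← key 1]
  conv_lhs => rw [plane_eq c]
  simp only [map_add, map_smul, smul_eq_mul]

/-- The derivative of a field of symmetric forms is symmetric. -/
lemma fderiv_symm {G : Plane → BilinForm} {y : Plane}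
    (hs : ∀ y a b, G y a b = G y b a) (hd : DifferentiableAt ℝ G y) (c a b : Plane) :
    fderiv ℝ G y c a b = fderiv ℝ G y c b a := by
  have h (a b : Plane) : HasFDerivAt (fun z => G z a b)
      (((ContinuousLinearMap.apply ℝ ℝ b).comp
        (ContinuousLinearMap.apply ℝ (Plane →L[ℝ] ℝ) a)).comp (fderiv ℝ G y)) y :=
    (((ContinuousLinearMap.apply ℝ ℝ b).comp
        (ContinuousLinearMap.apply ℝ (Plane →L[ℝ] ℝ) a)).hasFDerivAt (x := G y)).comp y
        hd.hasFDerivAt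
  have h2 := (h a b).unique ((h b a).congr_of_eventuallyEq (.of_forall fun z => hs z a b))
  simpa using DFunLike.congr_fun h2 c

/-- Compatibility of the Levi-Civita connection with the metric: `∇ G = 0`. -/
lemma fderiv_eq_symbol {G : Plane → BilinForm} {y : Plane}
    (hs : ∀ y a b, G y a b = G y b a) (hp : ∀ a, a ≠ 0 → 0 < G y a a)
    (hd : DifferentiableAt ℝ G y) (c a b : Plane) :
    fderiv ℝ G y c a b = G y (symbol G y c a) b + G y (symbol G y c b) a := by
  rw [inner_symbol (hs y) hp, inner_symbol (hs y) hp]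
  unfold lowerSymbol
  rw [fderiv_symm hs hd c b a, fderiv_symm hs hd b c a, fderiv_symm hs hd a c b]
  ring

lemma symbol_symm {G : Plane → BilinForm} {y : Plane}
    (hs : ∀ y a b, G y a b = G y b a) (hd : DifferentiableAt ℝ G y) (a b : Plane) :
    symbol G y a b = symbol G y b a := by
  unfold symbol
  congr 1
  funext k
  refine Finset.sum_congr rfl fun l _ => ?_
  congr 1
  unfold lowerSymbol
  rw [fderiv_symm hs hd _ a b]
  ring

lemma symbol_add_left (G : Plane → BilinForm) (y a a' b : Plane) :
    symbol G y (a + a') b = symbol G y a b + symbol G y a' b := by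
  ext k
  simp only [symbol, lowerSymbol, PiLp.add_apply, Fin.sum_univ_two, map_add, add_apply]
  ring

lemma symbol_smul_left (G : Plane → BilinForm) (y a b : Plane) (s : ℝ) :
    symbol G y (s • a) b = s • symbol G y a b := by
  ext k
  simp only [symbol, lowerSymbol, PiLp.smul_apply, Fin.sum_univ_two, map_smul, smul_apply,
    smul_eq_mul]
  ring

/-- The transformation law of the Christoffel symbols under a change of coordinates `τ`. -/
lemma fderiv_symbol {G H : Plane → BilinForm} {y : Plane} {τ : Plane → Plane}
    (hτ : ContDiffAt ℝ 2 τ y) (hsG : ∀ y a b, G y a b = G y b a)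
    (hpG : ∀ a, a ≠ 0 → 0 < G y a a) (hsH : ∀ y a b, H y a b = H y b a)
    (hpH : ∀ a, a ≠ 0 → 0 < H (τ y) a a)
    (hdG : DifferentiableAt ℝ G y) (hdH : DifferentiableAt ℝ H (τ y))
    (hsurj : Function.Surjective (fderiv ℝ τ y))
    (hGH : ∀ᶠ z in 𝓝 y, ∀ a b, G z a b = H (τ z) (fderiv ℝ τ z a) (fderiv ℝ τ z b))
    (a b : Plane) :
    fderiv ℝ τ y (symbol G y a b)
      = symbol H (τ y) (fderiv ℝ τ y a) (fderiv ℝ τ y b) + fderiv ℝ (fderiv ℝ τ) y a b := by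
  have hτ1 : DifferentiableAt ℝ τ y := hτ.differentiableAt (by norm_num)
  have hτ2 : DifferentiableAt ℝ (fderiv ℝ τ) y :=
    (hτ.fderiv_right (m := 1) (by norm_num)).differentiableAt (by norm_num)
  have hsymm : ∀ a b, fderiv ℝ (fderiv ℝ τ) y a b = fderiv ℝ (fderiv ℝ τ) y b a :=
    fun a b => (hτ.isSymmSndFDerivAt (by simp)).eq a b
  have hH : HasFDerivAt (fun z => H (τ z)) ((fderiv ℝ H (τ y)).comp (fderiv ℝ τ y)) y :=
    hdH.hasFDerivAt.comp y hτ1.hasFDerivAt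
  have hD : ∀ a, HasFDerivAt (fun z => fderiv ℝ τ z a)
      ((ContinuousLinearMap.apply ℝ Plane a).comp (fderiv ℝ (fderiv ℝ τ) y)) y := fun a =>
    ((ContinuousLinearMap.apply ℝ Plane a).hasFDerivAt (x := fderiv ℝ τ y)).comp y
      hτ2.hasFDerivAt
  have hder : ∀ c a b, fderiv ℝ G y c a b
      = fderiv ℝ H (τ y) (fderiv ℝ τ y c) (fderiv ℝ τ y a) (fderiv ℝ τ y b)
        + H (τ y) (fderiv ℝ (fderiv ℝ τ) y c a) (fderiv ℝ τ y b)
        + H (τ y) (fderiv ℝ τ y a) (fderiv ℝ (fderiv ℝ τ) y c b) := by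
    intro c a b
    have h1 := (hH.clm_apply (hD a)).clm_apply (hD b)
    have h2 : HasFDerivAt (fun z => G z a b)
      (((ContinuousLinearMap.apply ℝ ℝ b).comp
        (ContinuousLinearMap.apply ℝ (Plane →L[ℝ] ℝ) a)).comp (fderiv ℝ G y)) y :=
      (((ContinuousLinearMap.apply ℝ ℝ b).comp
        (ContinuousLinearMap.apply ℝ (Plane →L[ℝ] ℝ) a)).hasFDerivAt (x := G y)).comp y
        hdG.hasFDerivAt
    have h3 := DFunLike.congr_fun (h2.unique (h1.congr_of_eventuallyEq
      (hGH.mono fun z hz => hz a b))) c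
    simp at h3
    rw [h3]
    ring
  apply eq_of_forall_pairing hpH
  intro c'
  obtain ⟨c, rfl⟩ := hsurj c'
  rw [← hGH.self_of_nhds, map_add, add_apply, inner_symbol (hsG y) hpG,
    inner_symbol (hsH (τ y)) hpH]
  unfold lowerSymbol
  rw [hder, hder, hder, hsymm b a, hsymm c a, hsymm c b,
    hsH _ (fderiv ℝ τ y b) (fderiv ℝ (fderiv ℝ τ) y a c)]
  ring

variable {M : Type*} [TopologicalSpace M] [ChartedSpace Plane M] [IsManifold (𝓡 2) ∞ M]

/-! ### The metric in a chart -/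

/-- The coordinates of a tangent vector at `x` in the chart at `x₀`. -/
def toChart (x₀ x : M) : TangentSpace (𝓡 2) x →L[ℝ] Plane :=
  (trivializationAt Plane (TangentSpace (𝓡 2)) x₀).continuousLinearMapAt ℝ x

/-- The tangent vector at `x` with given coordinates in the chart at `x₀`. -/
def ofChart (x₀ x : M) : Plane →L[ℝ] TangentSpace (𝓡 2) x :=
  (trivializationAt Plane (TangentSpace (𝓡 2)) x₀).symmL ℝ x

lemma toChart_ofChart {x₀ x : M} (hx : x ∈ (chartAt Plane x₀).source) (a : Plane) :
    toChart x₀ x (ofChart x₀ x a) = a :=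
  Bundle.Trivialization.continuousLinearMapAt_symmL _ hx a

lemma ofChart_toChart {x₀ x : M} (hx : x ∈ (chartAt Plane x₀).source)
    (v : TangentSpace (𝓡 2) x) : ofChart x₀ x (toChart x₀ x v) = v :=
  Bundle.Trivialization.symmL_continuousLinearMapAt _ hx v

lemma toChart_self (x : M) (v : TangentSpace (𝓡 2) x) : toChart x x v = v := by
  unfold toChart
  rw [TangentBundle.continuousLinearMapAt_trivializationAt_eq_core (mem_chart_source _ x)]
  exact (tangentBundleCore (𝓡 2) M).coordChange_self _ _ (mem_chart_source _ x) v

lemma metricInChart_apply (g : RiemMetric M) (x₀ : M) (y a b : Plane) :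
    metricInChart g x₀ y a b = g.inner ((extChartAt (𝓡 2) x₀).symm y)
      (ofChart x₀ _ a) (ofChart x₀ _ b) := rfl

lemma metricInChart_symm (g : RiemMetric M) (x₀ : M) (y a b : Plane) :
    metricInChart g x₀ y a b = metricInChart g x₀ y b a :=
  g.symm _ _ _

lemma symm_mem_chart_source {x₀ : M} {y : Plane} (hy : y ∈ (extChartAt (𝓡 2) x₀).target) :
    (extChartAt (𝓡 2) x₀).symm y ∈ (chartAt Plane x₀).source := by
  rw [← extChartAt_source (𝓡 2)]
  exact (extChartAt (𝓡 2) x₀).map_target hy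

lemma metricInChart_pos (g : RiemMetric M) {x₀ : M} {y : Plane}
    (hy : y ∈ (extChartAt (𝓡 2) x₀).target) (a : Plane) (ha : a ≠ 0) :
    0 < metricInChart g x₀ y a a := by
  refine g.pos _ _ fun h => ha ?_
  have := toChart_ofChart (symm_mem_chart_source hy) a
  rw [← this]
  exact (congrArg _ h).trans (map_zero _)

lemma metricInChart_toChart (g : RiemMetric M) {x₀ x : M}
    (hx : x ∈ (chartAt Plane x₀).source) (v w : TangentSpace (𝓡 2) x) :
    metricInChart g x₀ (extChartAt (𝓡 2) x₀ x) (toChart x₀ x v) (toChart x₀ x w)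
      = g.inner x v w := by
  rw [metricInChart_apply, (extChartAt (𝓡 2) x₀).left_inv (by rwa [extChartAt_source]),
    ofChart_toChart hx, ofChart_toChart hx]

lemma metricInChart_self (g : RiemMetric M) (x : M) (v w : Plane) :
    metricInChart g x (extChartAt (𝓡 2) x x) v w
      = g.inner x (v : TangentSpace (𝓡 2) x) (w : TangentSpace (𝓡 2) x) := by
  exact (congrArg₂ (fun a b => metricInChart g x (extChartAt (𝓡 2) x x) a b)
    (toChart_self x v) (toChart_self x w)).symm.trans
    (metricInChart_toChart g (mem_chart_source Plane x) v w)

lemma contMDiffOn_ofChart (x₀ : M) (a : Plane) :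
    ContMDiffOn (𝓡 2) (𝓡 2).tangent ∞ (fun x => (⟨x, ofChart x₀ x a⟩ : TM M))
      (chartAt Plane x₀).source := by
  refine (Bundle.Trivialization.contMDiffOn_section_baseSet_iff (n := ∞) (IB := 𝓡 2)
    (trivializationAt Plane (TangentSpace (𝓡 2)) x₀)).2 ?_
  refine (contMDiffOn_const (c := a)).congr fun x hx => ?_
  have h := toChart_ofChart hx a
  unfold toChart at h
  rwa [Bundle.Trivialization.continuousLinearMapAt_apply,
    Bundle.Trivialization.coe_linearMapAt_of_mem _ hx] at h

lemma contDiffOn_metricInChart (g : RiemMetric M) (x₀ : M) :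
    ContDiffOn ℝ ∞ (metricInChart g x₀) (extChartAt (𝓡 2) x₀).target := by
  rw [contDiffOn_clm_apply]
  intro a
  rw [contDiffOn_clm_apply]
  intro b
  let : Bundle.RiemannianBundle (fun x : M => TangentSpace (𝓡 2) x) := ⟨g.toRiemannianMetric⟩
  have h : ContMDiffOn (𝓡 2) 𝓘(ℝ, ℝ) ∞ (fun x => g.inner x (ofChart x₀ x a) (ofChart x₀ x b))
      (chartAt Plane x₀).source :=
    ContMDiffOn.inner_bundle (contMDiffOn_ofChart x₀ a) (contMDiffOn_ofChart x₀ b)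
  exact (h.comp (contMDiffOn_extChartAt_symm x₀) fun y hy => symm_mem_chart_source hy).contDiffOn

lemma contDiffAt_metricInChart (g : RiemMetric M) {x₀ : M} {y : Plane}
    (hy : y ∈ (extChartAt (𝓡 2) x₀).target) : ContDiffAt ℝ ∞ (metricInChart g x₀) y :=
  (contDiffOn_metricInChart g x₀).contDiffAt ((isOpen_extChartAt_target x₀).mem_nhds hy)

/-! ### Change of charts -/

/-- The change of coordinates from the chart at `x` to the chart at `x₀`. -/
def transition (x x₀ : M) : Plane → Plane := extChartAt (𝓡 2) x₀ ∘ (extChartAt (𝓡 2) x).symm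

/-- The domain of the change of coordinates from the chart at `x` to the chart at `x₀`. -/
def transitionDomain (x x₀ : M) : Set Plane :=
  (extChartAt (𝓡 2) x).target ∩ (extChartAt (𝓡 2) x).symm ⁻¹' (chartAt Plane x₀).source

lemma isOpen_transitionDomain (x x₀ : M) : IsOpen (transitionDomain x x₀) :=
  (continuousOn_extChartAt_symm x).isOpen_inter_preimage (isOpen_extChartAt_target x)
    (chartAt Plane x₀).open_source

lemma mem_transitionDomain {x x₀ : M} (hx : x ∈ (chartAt Plane x₀).source) :
    extChartAt (𝓡 2) x x ∈ transitionDomain x x₀ :=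
  ⟨mem_extChartAt_target x, by rwa [Set.mem_preimage, extChartAt_to_inv]⟩

lemma contDiffAt_transition {x x₀ : M} {y : Plane} (hy : y ∈ transitionDomain x x₀) :
    ContDiffAt ℝ ∞ (transition x x₀) y := by
  have h : ContMDiffOn 𝓘(ℝ, Plane) 𝓘(ℝ, Plane) ∞ (transition x x₀) (transitionDomain x x₀) := by
    refine ContMDiffOn.comp (t := (chartAt Plane x₀).source) (I' := 𝓡 2) ?_
      ((contMDiffOn_extChartAt_symm x).mono Set.inter_subset_left) fun y hy => hy.2
    exact contMDiffOn_extChartAt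
  exact h.contDiffOn.contDiffAt ((isOpen_transitionDomain x x₀).mem_nhds hy)

/-- The tangent space at `x` is identified with the plane by the preferred chart at `x`; the
coordinates in another chart are obtained by the derivative of the change of charts. -/
lemma toChart_eq {x x₀ : M} (hx : x ∈ (chartAt Plane x₀).source) (v : TangentSpace (𝓡 2) x) :
    toChart x₀ x v = fderiv ℝ (transition x x₀) (extChartAt (𝓡 2) x x) v := by
  unfold toChart
  rw [TangentBundle.continuousLinearMapAt_trivializationAt_eq_core hx,
    tangentBundleCore_coordChange_achart, ModelWithCorners.Boundaryless.range_eq_univ,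
    fderivWithin_univ]
  rfl

/-- The derivative of a change of charts maps the coordinates of a tangent vector in the one chart to
those in the other, at every point of the common domain. -/
lemma toChart_ofChart_eq {x x₀ : M} {y : Plane} (hy : y ∈ transitionDomain x x₀) (a : Plane) :
    toChart x₀ ((extChartAt (𝓡 2) x).symm y) (ofChart x _ a)
      = fderiv ℝ (transition x x₀) y a := by
  have h1 := symm_mem_chart_source hy.1
  unfold toChart ofChart
  rw [TangentBundle.continuousLinearMapAt_trivializationAt_eq_core hy.2,
    TangentBundle.symmL_trivializationAt_eq_core h1]
  refine ((tangentBundleCore (𝓡 2) M).coordChange_comp _ _ _ _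
    ⟨⟨h1, mem_chart_source _ _⟩, hy.2⟩ a).trans ?_
  rw [tangentBundleCore_coordChange_achart, (extChartAt (𝓡 2) x).right_inv hy.1,
    ModelWithCorners.Boundaryless.range_eq_univ, fderivWithin_univ]
  rfl

/-- The coordinate expressions of a metric in two charts. -/
lemma metricInChart_transition (g : RiemMetric M) {x x₀ : M} {y : Plane}
    (hy : y ∈ transitionDomain x x₀) (a b : Plane) :
    metricInChart g x y a b = metricInChart g x₀ (transition x x₀ y)
      (fderiv ℝ (transition x x₀) y a) (fderiv ℝ (transition x x₀) y b) := by
  rw [← toChart_ofChart_eq hy, ← toChart_ofChart_eq hy, transition, Function.comp_apply,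
    metricInChart_toChart g hy.2, metricInChart_apply]

lemma christoffel_eq_symbol (g : RiemMetric M) (x₀ : M) :
    christoffel g x₀ = symbol (metricInChart g x₀) := rfl

lemma toChart_surjective {x x₀ : M} (hx : x ∈ (chartAt Plane x₀).source) :
    Function.Surjective (fderiv ℝ (transition x x₀) (extChartAt (𝓡 2) x x)) := fun a =>
  ⟨ofChart x₀ x a, by rw [← toChart_eq hx, toChart_ofChart hx]⟩

lemma transition_self {x x₀ : M} :
    transition x x₀ (extChartAt (𝓡 2) x x) = extChartAt (𝓡 2) x₀ x := by
  rw [transition, Function.comp_apply, extChartAt_to_inv]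

/-- The Christoffel symbols of a metric in the preferred chart at `x` and in another chart
around `x`. -/
lemma toChart_christoffel (g : RiemMetric M) {x x₀ : M} (hx : x ∈ (chartAt Plane x₀).source)
    (a b : Plane) :
    fderiv ℝ (transition x x₀) (extChartAt (𝓡 2) x x)
        (christoffel g x (extChartAt (𝓡 2) x x) a b)
      = christoffel g x₀ (extChartAt (𝓡 2) x₀ x)
          (fderiv ℝ (transition x x₀) (extChartAt (𝓡 2) x x) a)
          (fderiv ℝ (transition x x₀) (extChartAt (𝓡 2) x x) b)
        + fderiv ℝ (fderiv ℝ (transition x x₀)) (extChartAt (𝓡 2) x x) a b := by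
  have hx' := mem_transitionDomain hx
  have hmem : extChartAt (𝓡 2) x₀ x ∈ (extChartAt (𝓡 2) x₀).target :=
    (extChartAt (𝓡 2) x₀).map_source (by rwa [extChartAt_source])
  have h := fderiv_symbol (G := metricInChart g x) (H := metricInChart g x₀)
    (y := extChartAt (𝓡 2) x x) ((contDiffAt_transition hx').of_le (by norm_cast))
    (metricInChart_symm g x) (metricInChart_pos g hx'.1) (metricInChart_symm g x₀)
    (by rw [transition_self]; exact metricInChart_pos g hmem)
    ((contDiffAt_metricInChart g hx'.1).differentiableAt (by simp))
    (by rw [transition_self]; exact (contDiffAt_metricInChart g hmem).differentiableAt (by simp))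
    (toChart_surjective hx)
    (Filter.eventually_of_mem ((isOpen_transitionDomain x x₀).mem_nhds hx')
      fun z hz => metricInChart_transition g hz) a b
  rwa [transition_self] at h

/-! ### The rotation in a chart -/

lemma rot_rot (g : RiemMetric M) (o : SurfaceOrientation M) (x : M) (v : TangentSpace (𝓡 2) x) :
    rot g o x (rot g o x v) = -v := by
  let : Bundle.RiemannianBundle (fun x : M => TangentSpace (𝓡 2) x) := ⟨g.toRiemannianMetric⟩
  exact (o.at' x).rightAngleRotation_rightAngleRotation v

lemma inner_rot_rot (g : RiemMetric M) (o : SurfaceOrientation M) (x : M)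
    (v w : TangentSpace (𝓡 2) x) :
    g.inner x (rot g o x v) (rot g o x w) = g.inner x v w := by
  let : Bundle.RiemannianBundle (fun x : M => TangentSpace (𝓡 2) x) := ⟨g.toRiemannianMetric⟩
  exact (o.at' x).inner_comp_rightAngleRotation v w

lemma rot_add (g : RiemMetric M) (o : SurfaceOrientation M) (x : M)
    (v w : TangentSpace (𝓡 2) x) : rot g o x (v + w) = rot g o x v + rot g o x w := by
  let : Bundle.RiemannianBundle (fun x : M => TangentSpace (𝓡 2) x) := ⟨g.toRiemannianMetric⟩
  exact map_add (o.at' x).rightAngleRotation v w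

lemma rot_smul (g : RiemMetric M) (o : SurfaceOrientation M) (x : M) (c : ℝ)
    (v : TangentSpace (𝓡 2) x) : rot g o x (c • v) = c • rot g o x v := by
  let : Bundle.RiemannianBundle (fun x : M => TangentSpace (𝓡 2) x) := ⟨g.toRiemannianMetric⟩
  exact map_smul (o.at' x).rightAngleRotation c v

/-- The standard basis of the plane. -/
def stdBasis : Module.Basis (Fin 2) ℝ Plane := (EuclideanSpace.basisFun (Fin 2) ℝ).toBasis

lemma stdBasis_det (a b : Plane) : stdBasis.det ![a, b] = wedge a b := by
  rw [Module.Basis.det_apply, Matrix.det_fin_two]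
  simp [Module.Basis.toMatrix_apply, stdBasis, wedge]
  ring

open Classical in
/-- The sign of an orientation of the plane, relative to the standard one. -/
def planeSign (o : Orientation ℝ Plane (Fin 2)) : ℝ := if o = stdBasis.orientation then 1 else -1

/-- The orientation of the tangent plane at `x`, read in the chart at `x₀`. -/
def orientationInChart (o : SurfaceOrientation M) {x₀ x : M}
    (hx : x ∈ (chartAt Plane x₀).source) : Orientation ℝ Plane (Fin 2) :=
  Orientation.map (Fin 2)
    ((trivializationAt Plane (TangentSpace (𝓡 2)) x₀).linearEquivAt ℝ x hx) (o.at' x)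

/-- The area form of `g` in a chart is `± √(det g)` times the standard area form, with a sign which
depends on the orientation only. -/
lemma inner_rot (g : RiemMetric M) (o : SurfaceOrientation M) {x₀ x : M}
    (hx : x ∈ (chartAt Plane x₀).source) (v w : TangentSpace (𝓡 2) x) :
    g.inner x (rot g o x v) w = planeSign (orientationInChart o hx) *
      √(gramDet (metricInChart g x₀ (extChartAt (𝓡 2) x₀ x)) (stdVec 0) (stdVec 1))
        * wedge (toChart x₀ x v) (toChart x₀ x w) := by
  let : Bundle.RiemannianBundle (fun x : M => TangentSpace (𝓡 2) x) := ⟨g.toRiemannianMetric⟩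
  let T := (trivializationAt Plane (TangentSpace (𝓡 2)) x₀).linearEquivAt ℝ x hx
  have hT : ∀ v, T v = toChart x₀ x v := fun v => by
    unfold toChart
    rw [Bundle.Trivialization.continuousLinearMapAt_apply,
      Bundle.Trivialization.coe_linearMapAt_of_mem _ hx]
    rfl
  let b := (o.at' x).finOrthonormalBasis two_pos (finrankTangent x).out
  have hb : b.toBasis.orientation = o.at' x := Orientation.finOrthonormalBasis_orientation _ _ _
  let B := b.toBasis.map T
  have hB : B.orientation = orientationInChart o hx := by
    rw [Module.Basis.orientation_map, hb]
    rfl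
  have harea : ∀ v w : TangentSpace (𝓡 2) x,
      (o.at' x).areaForm v w = B.det stdBasis * wedge (T v) (T w) := by
    intro v w
    have h1 := AlternatingMap.eq_smul_basis_det stdBasis B.det
    rw [Orientation.areaForm_to_volumeForm, Orientation.volumeForm_robust _ b hb,
      ← stdBasis_det]
    have h2 : B.det ![T v, T w] = b.toBasis.det ![v, w] := by
      rw [Module.Basis.det_map]
      congr 1
      ext i
      fin_cases i <;> simp
    rw [← h2]
    exact congrFun (congrArg DFunLike.coe h1) ![T v, T w]
  have hsq : B.det stdBasis ^ 2
      = gramDet (metricInChart g x₀ (extChartAt (𝓡 2) x₀ x)) (stdVec 0) (stdVec 1) := by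
    have h1 := (o.at' x).inner_sq_add_areaForm_sq (T.symm (stdVec 0)) (T.symm (stdVec 1))
    rw [harea, T.apply_symm_apply, T.apply_symm_apply, ← real_inner_self_eq_norm_sq,
      ← real_inner_self_eq_norm_sq] at h1
    have h2 : ∀ v w : TangentSpace (𝓡 2) x, inner ℝ v w
        = metricInChart g x₀ (extChartAt (𝓡 2) x₀ x) (T v) (T w) := fun v w => by
      rw [hT, hT, metricInChart_toChart g hx]
      rfl
    rw [h2, h2, h2, T.apply_symm_apply, T.apply_symm_apply] at h1
    have h3 : wedge (stdVec 0) (stdVec 1) = 1 := by simp [wedge]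
    rw [h3] at h1
    unfold gramDet
    linarith
  have hsign : B.det stdBasis = planeSign (orientationInChart o hx) * √(B.det stdBasis ^ 2) := by
    rw [Real.sqrt_sq_eq_abs, ← hB, planeSign]
    have hiff := Module.Basis.orientation_eq_iff_det_pos B stdBasis
    split_ifs with h
    · rw [abs_of_pos (hiff.1 h), one_mul]
    · rw [abs_of_nonpos (not_lt.1 fun h' => h (hiff.2 h'))]
      ring
  rw [← hsq, ← hsign, ← hT, ← hT, ← harea]
  exact (o.at' x).inner_rightAngleRotation_left v w

/-- The quarter turn of a metric on the plane, for the orientation of the given sign. -/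
def planeRot (s : ℝ) (B : BilinForm) (a : Plane) : Plane :=
  (s / √(gramDet B (stdVec 0) (stdVec 1))) •
    (-(B (stdVec 1) a) • stdVec 0 + B (stdVec 0) a • stdVec 1)

lemma inner_planeRot (s : ℝ) {B : BilinForm} (hs : ∀ a b, B a b = B b a)
    (hp : ∀ a, a ≠ 0 → 0 < B a a) (a b : Plane) :
    B (planeRot s B a) b = s * √(gramDet B (stdVec 0) (stdVec 1)) * wedge a b := by
  have hpos := gramDet_std_pos hs hp
  have hsq := Real.sq_sqrt hpos.le
  have hne := (Real.sqrt_pos.2 hpos).ne'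
  unfold planeRot
  generalize √(gramDet B (stdVec 0) (stdVec 1)) = r at *
  have h : -(B (stdVec 1) a) * B (stdVec 0) b + B (stdVec 0) a * B (stdVec 1) b
      = r ^ 2 * wedge a b := by
    rw [hsq, gramDet, wedge, bilin_expand B (stdVec 1) a, bilin_expand B (stdVec 0) a,
      bilin_expand B (stdVec 1) b, bilin_expand B (stdVec 0) b, hs (stdVec 1) (stdVec 0)]
    simp
    ring
  simp only [map_add, map_smul, add_apply, smul_apply, smul_eq_mul]
  rw [h]
  field_simp

lemma extChartAt_mem_target {x₀ x : M} (hx : x ∈ (chartAt Plane x₀).source) :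
    extChartAt (𝓡 2) x₀ x ∈ (extChartAt (𝓡 2) x₀).target :=
  (extChartAt (𝓡 2) x₀).map_source (by rwa [extChartAt_source])

/-- The rotation `J` in a chart. -/
lemma toChart_rot (g : RiemMetric M) (o : SurfaceOrientation M) {x₀ x : M}
    (hx : x ∈ (chartAt Plane x₀).source) (v : TangentSpace (𝓡 2) x) :
    toChart x₀ x (rot g o x v) = planeRot (planeSign (orientationInChart o hx))
      (metricInChart g x₀ (extChartAt (𝓡 2) x₀ x)) (toChart x₀ x v) := by
  have hp := metricInChart_pos g (extChartAt_mem_target hx)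
  apply eq_of_forall_pairing hp
  intro c
  rw [inner_planeRot _ (metricInChart_symm g x₀ _) hp, ← toChart_ofChart hx c,
    metricInChart_toChart g hx, inner_rot g o hx]

/-- The orientation has locally constant sign in a chart. -/
lemma eventually_planeSign (o : SurfaceOrientation M) (x₀ : M) : ∃ s : ℝ, ∀ᶠ x in 𝓝 x₀,
    ∃ hx : x ∈ (chartAt Plane x₀).source, planeSign (orientationInChart o hx) = s := by
  obtain ⟨o₀, h⟩ := o.locallyConstant x₀
  refine ⟨planeSign o₀, h.mono fun x hx => ?_⟩
  obtain ⟨hx, h⟩ := hx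
  exact ⟨hx, congrArg planeSign h⟩

/-! ### Charts of the tangent bundle -/

/-- The fibre component of a point `u` of the tangent bundle, as a vector of the model plane: its
coordinates in the preferred chart at the base point of `u`. -/
def vec (u : TM M) : Plane := u.2

/-- The rotation `J` of the tangent plane at `x`, as a map of the model plane. -/
def planeJ (g : RiemMetric M) (o : SurfaceOrientation M) (x : M) (a : Plane) : Plane :=
  rot g o x (a : TangentSpace (𝓡 2) x)

lemma extChartAt_tangent_apply (u w : TM M) (hw : w.1 ∈ (chartAt Plane u.1).source) :
    extChartAt (𝓡 2).tangent u w = (extChartAt (𝓡 2) u.1 w.1, toChart u.1 w.1 w.2) := by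
  rw [FiberBundle.extChartAt]
  unfold toChart
  rw [Bundle.Trivialization.continuousLinearMapAt_apply,
    Bundle.Trivialization.coe_linearMapAt_of_mem _ hw]
  rfl

lemma extChartAt_tangent_self (u : TM M) :
    extChartAt (𝓡 2).tangent u u = (extChartAt (𝓡 2) u.1 u.1, vec u) := by
  rw [extChartAt_tangent_apply u u (mem_chart_source _ _)]
  exact Prod.ext rfl (toChart_self u.1 u.2)

lemma extChartAt_tangent_symm_apply (u : TM M) {y : Plane}
    (hy : y ∈ (extChartAt (𝓡 2) u.1).target) (a : Plane) :
    (extChartAt (𝓡 2).tangent u).symm (y, a) =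
      ⟨(extChartAt (𝓡 2) u.1).symm y, ofChart u.1 _ a⟩ := by
  have h1 : (⟨(extChartAt (𝓡 2) u.1).symm y, ofChart u.1 _ a⟩ : TM M)
      ∈ (extChartAt (𝓡 2).tangent u).source := by
    rw [extChartAt_source, TangentBundle.mem_chart_source_iff]
    exact symm_mem_chart_source hy
  rw [← (extChartAt (𝓡 2).tangent u).left_inv h1,
    extChartAt_tangent_apply _ _ (symm_mem_chart_source hy),
    toChart_ofChart (symm_mem_chart_source hy), (extChartAt (𝓡 2) u.1).right_inv hy]

lemma eventually_fst_mem_target (x : M) (a : Plane) :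
    ∀ᶠ z : Plane × Plane in 𝓝 (extChartAt (𝓡 2) x x, a), z.1 ∈ (extChartAt (𝓡 2) x).target :=
  continuousAt_fst.eventually ((isOpen_extChartAt_target x).mem_nhds (mem_extChartAt_target x))

/-- The derivative of a map on the tangent bundle is computed in the preferred chart. -/
lemma hasMFDerivAt_of_chart {F : Type*} [NormedAddCommGroup F] [NormedSpace ℝ F]
    {f : TM M → F} {u : TM M} (hf : ContinuousAt f u) {h : Plane × Plane → F}
    {h' : Plane × Plane →L[ℝ] F}
    (hh : HasFDerivAt h h' (extChartAt (𝓡 2) u.1 u.1, vec u))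
    (heq : ∀ᶠ z : Plane × Plane in 𝓝 (extChartAt (𝓡 2) u.1 u.1, vec u),
      f ⟨(extChartAt (𝓡 2) u.1).symm z.1, ofChart u.1 _ z.2⟩ = h z) :
    HasMFDerivAt (𝓡 2).tangent 𝓘(ℝ, F) f u h' := by
  refine ⟨hf, ?_⟩
  refine HasFDerivAt.hasFDerivWithinAt ?_
  rw [extChartAt_tangent_self]
  refine hh.congr_of_eventuallyEq ?_
  filter_upwards [heq, eventually_fst_mem_target u.1 (vec u)] with z hz hz1
  rw [← hz]
  simp only [writtenInExtChartAt, extChartAt_model_space_eq_id, PartialEquiv.refl_coe,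
    Function.comp_apply, id_eq]
  exact congrArg f (extChartAt_tangent_symm_apply u hz1 z.2)

lemma contMDiff_normSq (g : RiemMetric M) :
    ContMDiff (𝓡 2).tangent 𝓘(ℝ, ℝ) ∞ (normSq g) := by
  let : Bundle.RiemannianBundle (fun x : M => TangentSpace (𝓡 2) x) := ⟨g.toRiemannianMetric⟩
  exact ContMDiff.inner_bundle (F := Plane) (E := fun x : M => TangentSpace (𝓡 2) x)
    (IB := 𝓡 2) (b := fun u : TM M => u.1) (v := fun u => u.2) (w := fun u => u.2)
    contMDiff_id contMDiff_id

lemma normSq_pos (g : RiemMetric M) {u : TM M} (hu : u.2 ≠ 0) : 0 < normSq g u :=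
  g.pos u.1 u.2 hu

lemma isOpen_ne_zero (g : RiemMetric M) : IsOpen {u : TM M | u.2 ≠ 0} := by
  have h : {u : TM M | u.2 ≠ 0} = {u | normSq g u ≠ 0} := by
    ext u
    refine ⟨fun hu => (normSq_pos g hu).ne', fun hu h0 => hu ?_⟩
    rw [normSq, h0]
    simp
  rw [h]
  exact isOpen_ne_fun (contMDiff_normSq g).continuous continuous_const

lemma SmoothOnSM.contMDiffAt {g : RiemMetric M} {f : UnitTangent g → ℝ} (hf : SmoothOnSM g f)
    {u : TM M} (hu : u.2 ≠ 0) : ContMDiffAt (𝓡 2).tangent 𝓘(ℝ, ℝ) ∞ (extend g f) u :=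
  ContMDiffOn.contMDiffAt hf ((isOpen_ne_zero g).mem_nhds hu)

/-! ### The generator of a thermostat in a chart -/

/-- The coordinate expression `(a, -Γ(a, a) + l J a)` of the generator of a thermostat; here `l` is
the value of the function `λ`, and `s` the sign of the orientation. -/
def fieldInChart (s : ℝ) (G : Plane → BilinForm) (z : (Plane × Plane) × ℝ) : Plane × Plane :=
  (z.1.2, -symbol G z.1.1 z.1.2 z.1.2 + z.2 • planeRot s (G z.1.1) z.1.2)

lemma thermostatField_eq (g : RiemMetric M) (o : SurfaceOrientation M) (lam : UnitTangent g → ℝ)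
    (u : TM M) : (thermostatField g o lam u : Plane × Plane) =
      (vec u, -christoffel g u.1 (extChartAt (𝓡 2) u.1 u.1) (vec u) (vec u)
        + extend g lam u • planeJ g o u.1 (vec u)) := by
  change ((vec u, -christoffel g u.1 (extChartAt (𝓡 2) u.1 u.1) (vec u) (vec u)) : Plane × Plane)
    + extend g lam u • (((0 : Plane), planeJ g o u.1 (vec u)) : Plane × Plane) = _
  rw [Prod.smul_mk, Prod.mk_add_mk, smul_zero, add_zero]

/-- The derivative of the change of charts of the tangent bundle. -/
lemma hasFDerivAt_tangent_transition {x x₀ : M} (hx : x ∈ (chartAt Plane x₀).source) (a : Plane) :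
    HasFDerivAt (fun z : Plane × Plane => (transition x x₀ z.1, fderiv ℝ (transition x x₀) z.1 z.2))
      (((fderiv ℝ (transition x x₀) (extChartAt (𝓡 2) x x)).comp
          (ContinuousLinearMap.fst ℝ Plane Plane)).prod
        ((fderiv ℝ (transition x x₀) (extChartAt (𝓡 2) x x)).comp
          (ContinuousLinearMap.snd ℝ Plane Plane) +
        ((fderiv ℝ (fderiv ℝ (transition x x₀)) (extChartAt (𝓡 2) x x)).comp
          (ContinuousLinearMap.fst ℝ Plane Plane)).flip a))
      (extChartAt (𝓡 2) x x, a) := by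
  have hτ := contDiffAt_transition (mem_transitionDomain hx)
  have h1 := (hτ.differentiableAt (by simp)).hasFDerivAt
  have h2 := ((hτ.fderiv_right (m := 1) (by norm_cast)).differentiableAt (by norm_num)).hasFDerivAt
  have hf : HasFDerivAt (Prod.fst : Plane × Plane → Plane) (ContinuousLinearMap.fst ℝ Plane Plane)
    (extChartAt (𝓡 2) x x, a) := hasFDerivAt_fst
  have hs : HasFDerivAt (Prod.snd : Plane × Plane → Plane) (ContinuousLinearMap.snd ℝ Plane Plane)
    (extChartAt (𝓡 2) x x, a) := hasFDerivAt_snd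
  exact (h1.comp (extChartAt (𝓡 2) x x, a) hf).prodMk
    ((h2.comp (extChartAt (𝓡 2) x x, a) hf).clm_apply hs)

/-- The generator of a thermostat, read in a chart of the tangent bundle. -/
lemma trivializationAt_thermostatField (g : RiemMetric M) (o : SurfaceOrientation M)
    (lam : UnitTangent g → ℝ) (u₀ u : TM M) (hu : u.1 ∈ (chartAt Plane u₀.1).source) :
    (trivializationAt (Plane × Plane) (TangentSpace (𝓡 2).tangent) u₀
        ⟨u, thermostatField g o lam u⟩).2 =
      fieldInChart (planeSign (orientationInChart o hu)) (metricInChart g u₀.1)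
        (extChartAt (𝓡 2).tangent u₀ u, extend g lam u) := by
  have hev : extChartAt (𝓡 2).tangent u₀ ∘ (extChartAt (𝓡 2).tangent u).symm
      =ᶠ[𝓝 (extChartAt (𝓡 2) u.1 u.1, vec u)]
      fun z => (transition u.1 u₀.1 z.1, fderiv ℝ (transition u.1 u₀.1) z.1 z.2) := by
    have h1 : ∀ᶠ z : Plane × Plane in 𝓝 (extChartAt (𝓡 2) u.1 u.1, vec u),
        z.1 ∈ transitionDomain u.1 u₀.1 :=
      continuousAt_fst.eventually
        ((isOpen_transitionDomain u.1 u₀.1).mem_nhds (mem_transitionDomain hu))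
    filter_upwards [h1] with z hz
    obtain ⟨y, a⟩ := z
    rw [Function.comp_apply, extChartAt_tangent_symm_apply u hz.1,
      extChartAt_tangent_apply u₀ ⟨(extChartAt (𝓡 2) u.1).symm y, ofChart u.1 _ a⟩ hz.2,
      toChart_ofChart_eq hz]
    rfl
  have hchr := toChart_christoffel g hu (vec u) (vec u)
  have hvec : toChart u₀.1 u.1 u.2
    = fderiv ℝ (transition u.1 u₀.1) (extChartAt (𝓡 2) u.1 u.1) (vec u) := toChart_eq hu u.2
  have hrot : fderiv ℝ (transition u.1 u₀.1) (extChartAt (𝓡 2) u.1 u.1) (planeJ g o u.1 (vec u))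
      = _ := (toChart_eq hu (rot g o u.1 u.2)).symm.trans (toChart_rot g o hu u.2)
  rw [TangentBundle.trivializationAt_apply]
  change fderivWithin ℝ (extChartAt (𝓡 2).tangent u₀ ∘ (extChartAt (𝓡 2).tangent u).symm)
    (Set.range (𝓡 2).tangent) (extChartAt (𝓡 2).tangent u u)
      (thermostatField g o lam u : Plane × Plane) = _
  rw [ModelWithCorners.Boundaryless.range_eq_univ, fderivWithin_univ, extChartAt_tangent_self,
    extChartAt_tangent_apply u₀ u hu, hev.fderiv_eq,
    (hasFDerivAt_tangent_transition hu (vec u)).fderiv, thermostatField_eq]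
  unfold fieldInChart
  rw [hvec] at hrot ⊢
  refine Prod.ext rfl ?_
  simp only [ContinuousLinearMap.prod_apply, add_apply, ContinuousLinearMap.comp_apply,
    ContinuousLinearMap.flip_apply, ContinuousLinearMap.coe_fst', ContinuousLinearMap.coe_snd',
    map_add, map_neg, map_smul]
  rw [hchr, christoffel_eq_symbol, hrot]
  abel

/-! ### Smoothness of the generator and existence of orbits -/

section Smooth

variable {X : Type*} [NormedAddCommGroup X] [NormedSpace ℝ X] {G : Plane → BilinForm}
  {f h : X → Plane} {x : X}

lemma contDiffAt_gramMatrix_inv {B : X → BilinForm} (hB : ContDiffAt ℝ 1 B x)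
    (hdet : (gramMatrix (B x)).det ≠ 0) (k l : Fin 2) :
    ContDiffAt ℝ 1 (fun z => (gramMatrix (B z))⁻¹ k l) x := by
  have hent : ∀ i j, ContDiffAt ℝ 1 (fun z => gramMatrix (B z) i j) x := fun i j =>
    (hB.clm_apply contDiffAt_const).clm_apply contDiffAt_const
  have hd : ContDiffAt ℝ 1 (fun z => (gramMatrix (B z)).det) x := by
    simp only [Matrix.det_fin_two]
    exact ((hent 0 0).mul (hent 1 1)).sub ((hent 0 1).mul (hent 1 0))
  simp only [Matrix.inv_def, Matrix.smul_apply, smul_eq_mul, Ring.inverse_eq_inv']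
  refine (hd.inv hdet).mul ?_
  simp only [Matrix.adjugate_fin_two]
  fin_cases k <;> fin_cases l <;> simp only [Matrix.of_apply, Matrix.cons_val', Fin.zero_eta,
    Fin.mk_one, Matrix.cons_val_zero, Matrix.cons_val_one, Matrix.cons_val_fin_one]
  exacts [hent 1 1, (hent 0 1).neg, (hent 1 0).neg, hent 0 0]

lemma contDiffAt_symbol (hG : ContDiffAt ℝ ∞ G (f x)) (hs : ∀ a b, G (f x) a b = G (f x) b a)
    (hp : ∀ a, a ≠ 0 → 0 < G (f x) a a) (hf : ContDiffAt ℝ 1 f x) (hh : ContDiffAt ℝ 1 h x) :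
    ContDiffAt ℝ 1 (fun z => symbol G (f z) (h z) (h z)) x := by
  have hB : ContDiffAt ℝ 1 (fun z => G (f z)) x :=
    (hG.of_le (by norm_cast)).comp x hf
  have hD : ContDiffAt ℝ 1 (fun z => fderiv ℝ G (f z)) x :=
    (hG.fderiv_right (m := 1) (by norm_cast)).comp x hf
  have hdet : (gramMatrix (G (f x))).det ≠ 0 := by
    rw [det_gramMatrix hs]
    exact (gramDet_std_pos hs hp).ne'
  have hlow : ∀ c, ContDiffAt ℝ 1 (fun z => lowerSymbol G (f z) (h z) (h z) c) x := fun c => by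
    unfold lowerSymbol
    have hc : ContDiffAt ℝ 1 (fun _ : X => c) x := contDiffAt_const
    exact contDiffAt_const.mul (((((hD.clm_apply hh).clm_apply hh).clm_apply hc).add
      (((hD.clm_apply hh).clm_apply hh).clm_apply hc)).sub
      (((hD.clm_apply hc).clm_apply hh).clm_apply hh))
  rw [contDiffAt_euclidean]
  intro k
  simp only [symbol]
  exact ContDiffAt.sum fun l _ => (contDiffAt_gramMatrix_inv hB hdet k l).mul (hlow _)

lemma contDiffAt_planeRot {B : X → BilinForm} (s : ℝ) (hB : ContDiffAt ℝ 1 B x)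
    (hs : ∀ a b, B x a b = B x b a) (hp : ∀ a, a ≠ 0 → 0 < B x a a)
    (hh : ContDiffAt ℝ 1 h x) : ContDiffAt ℝ 1 (fun z => planeRot s (B z) (h z)) x := by
  have hc : ∀ c, ContDiffAt ℝ 1 (fun _ : X => (c : Plane)) x := fun c => contDiffAt_const
  have hpos := gramDet_std_pos hs hp
  have hg : ContDiffAt ℝ 1 (fun z => gramDet (B z) (stdVec 0) (stdVec 1)) x := by
    unfold gramDet
    exact (((hB.clm_apply (hc _)).clm_apply (hc _)).mul
      ((hB.clm_apply (hc _)).clm_apply (hc _))).sub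
      (((hB.clm_apply (hc _)).clm_apply (hc _)).pow 2)
  unfold planeRot
  refine ContDiffAt.smul (contDiffAt_const.div (hg.sqrt hpos.ne') (Real.sqrt_pos.2 hpos).ne') ?_
  exact (((hB.clm_apply (hc _)).clm_apply hh).neg.smul (hc _)).add
    (((hB.clm_apply (hc _)).clm_apply hh).smul (hc _))

lemma contDiffAt_fieldInChart (s : ℝ) {z : (Plane × Plane) × ℝ} (hG : ContDiffAt ℝ ∞ G z.1.1)
    (hs : ∀ a b, G z.1.1 a b = G z.1.1 b a) (hp : ∀ a, a ≠ 0 → 0 < G z.1.1 a a) :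
    ContDiffAt ℝ 1 (fieldInChart s G) z := by
  have h1 : ContDiffAt ℝ 1 (fun z : (Plane × Plane) × ℝ => z.1.1) z :=
    contDiffAt_fst.comp z contDiffAt_fst
  have h2 : ContDiffAt ℝ 1 (fun z : (Plane × Plane) × ℝ => z.1.2) z :=
    contDiffAt_snd.comp z contDiffAt_fst
  have h3 : ContDiffAt ℝ 1 (fun z : (Plane × Plane) × ℝ => G z.1.1) z :=
    (hG.of_le (by norm_cast)).comp z h1
  exact h2.prodMk ((contDiffAt_symbol (f := fun z : (Plane × Plane) × ℝ => z.1.1) hG hs hp h1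
    h2).neg.add (contDiffAt_snd.smul (contDiffAt_planeRot s h3 hs hp h2)))

end Smooth

/-- The generator of a thermostat is a continuously differentiable vector field off the zero
section. -/
lemma contMDiffAt_thermostatField (g : RiemMetric M) (o : SurfaceOrientation M)
    {lam : UnitTangent g → ℝ} (hlam : SmoothOnSM g lam) {u₀ : TM M} (hu₀ : u₀.2 ≠ 0) :
    ContMDiffAt (𝓡 2).tangent (𝓡 2).tangent.tangent 1
      (fun u => (⟨u, thermostatField g o lam u⟩ : TangentBundle (𝓡 2).tangent (TM M))) u₀ := by
  refine (Bundle.contMDiffAt_section (F := Plane × Plane) (IB := (𝓡 2).tangent)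
    (E := TangentSpace (𝓡 2).tangent (M := TM M)) (s := thermostatField g o lam) u₀).2 ?_
  obtain ⟨s, hs⟩ := eventually_planeSign o u₀.1
  have hmem := mem_extChartAt_target (I := 𝓡 2) u₀.1
  have hW : ContDiffAt ℝ 1 (fieldInChart s (metricInChart g u₀.1))
      (extChartAt (𝓡 2).tangent u₀ u₀, extend g lam u₀) := by
    rw [extChartAt_tangent_self]
    exact contDiffAt_fieldInChart s (contDiffAt_metricInChart g hmem)
      (metricInChart_symm g u₀.1 _) (metricInChart_pos g hmem)
  have h1 : ContMDiffAt (𝓡 2).tangent 𝓘(ℝ, (Plane × Plane) × ℝ) 1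
      (fun u => (extChartAt (𝓡 2).tangent u₀ u, extend g lam u)) u₀ :=
    (contMDiffAt_extChartAt (n := 1)).prodMk_space ((hlam.contMDiffAt hu₀).of_le (by norm_cast))
  refine (hW.contMDiffAt.comp u₀ h1).congr_of_eventuallyEq ?_
  have hcont : ContinuousAt (fun u : TM M => u.1) u₀ :=
    (Bundle.contMDiff_proj (n := ∞) (IB := 𝓡 2) (TangentSpace (𝓡 2) (M := M))).continuous.continuousAt
  filter_upwards [hcont.eventually hs] with u hu
  obtain ⟨hu, rfl⟩ := hu
  exact trivializationAt_thermostatField g o lam u₀ u hu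

lemma planeJ_spec (g : RiemMetric M) (o : SurfaceOrientation M) (x : M) (a b : Plane) :
    metricInChart g x (extChartAt (𝓡 2) x x) (planeJ g o x a) b =
      planeSign (orientationInChart o (mem_chart_source Plane x)) *
      √(gramDet (metricInChart g x (extChartAt (𝓡 2) x x)) (stdVec 0) (stdVec 1)) * wedge a b := by
  rw [metricInChart_self]
  refine (inner_rot g o (mem_chart_source Plane x) (a : TangentSpace (𝓡 2) x) b).trans ?_
  exact congrArg₂ (fun p q => _ * wedge p q) (toChart_self x a) (toChart_self x b)

lemma planeJ_orthogonal (g : RiemMetric M) (o : SurfaceOrientation M) (x : M) (a : Plane) :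
    metricInChart g x (extChartAt (𝓡 2) x x) a (planeJ g o x a) = 0 := by
  rw [metricInChart_symm, planeJ_spec, wedge]
  ring

lemma exists_hasFDerivAt_quadratic {G : Plane → BilinForm} {y : Plane}
    (hs : ∀ a b, G y a b = G y b a) (hd : DifferentiableAt ℝ G y) (a : Plane) :
    ∃ L : Plane × Plane →L[ℝ] ℝ, HasFDerivAt (fun z : Plane × Plane => G z.1 z.2 z.2) L (y, a) ∧
      ∀ b c, L (b, c) = fderiv ℝ G y b a a + 2 * G y a c := by
  have hf : HasFDerivAt (Prod.fst : Plane × Plane → Plane) (ContinuousLinearMap.fst ℝ Plane Plane)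
    (y, a) := hasFDerivAt_fst
  have hs' : HasFDerivAt (Prod.snd : Plane × Plane → Plane) (ContinuousLinearMap.snd ℝ Plane Plane)
    (y, a) := hasFDerivAt_snd
  refine ⟨_, ((hd.hasFDerivAt.comp (y, a) hf).clm_apply hs').clm_apply hs', fun b c => ?_⟩
  simp only [add_apply, ContinuousLinearMap.comp_apply,
    ContinuousLinearMap.flip_apply, ContinuousLinearMap.coe_fst', ContinuousLinearMap.coe_snd',
    Function.comp_apply]
  rw [hs c a]
  ring

/-- The generator of a thermostat annihilates the squared length of tangent vectors. -/
lemma mfderiv_normSq_thermostatField (g : RiemMetric M) (o : SurfaceOrientation M)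
    (lam : UnitTangent g → ℝ) (u : TM M) :
    mfderiv (𝓡 2).tangent 𝓘(ℝ, ℝ) (normSq g) u (thermostatField g o lam u) = (0 : ℝ) := by
  have hmem := mem_extChartAt_target (I := 𝓡 2) u.1
  have hd := (contDiffAt_metricInChart g hmem).differentiableAt (by simp)
  obtain ⟨L, h, hL⟩ := exists_hasFDerivAt_quadratic (metricInChart_symm g u.1 _) hd (vec u)
  have h2 := hasMFDerivAt_of_chart (f := normSq g) (u := u)
    (contMDiff_normSq g).continuous.continuousAt h (.of_forall fun z => rfl)
  have h3 := fderiv_eq_symbol (metricInChart_symm g u.1) (metricInChart_pos g hmem) hd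
    (vec u) (vec u) (vec u)
  have h5 : mfderiv (𝓡 2).tangent 𝓘(ℝ, ℝ) (normSq g) u (thermostatField g o lam u)
      = L (thermostatField g o lam u : Plane × Plane) := by
    rw [h2.mfderiv]
    rfl
  suffices h6 : L (thermostatField g o lam u : Plane × Plane) = 0 from h5.trans h6
  rw [thermostatField_eq, hL, h3, christoffel_eq_symbol, map_add, map_smul, map_neg,
    planeJ_orthogonal, metricInChart_symm g _ _ (vec u)]
  simp only [smul_eq_mul]
  ring

lemma hasDerivAt_of_comp_smulRight {E F : Type*} [NormedAddCommGroup E] [NormedSpace ℝ E]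
    [NormedAddCommGroup F] [NormedSpace ℝ F] {k : ℝ → F} {L : E →L[ℝ] F} {e : E} {t : ℝ}
    (h : HasFDerivAt k (L.comp ((1 : ℝ →L[ℝ] ℝ).smulRight e)) t) : HasDerivAt k (L e) t := by
  simpa using h.hasDerivAt

/-- The derivative of a function along an integral curve of the generator of a thermostat. -/
lemma hasDerivAt_comp_integralCurve {g : RiemMetric M} {o : SurfaceOrientation M}
    {lam : UnitTangent g → ℝ} {s : Set ℝ} {δ : ℝ → TM M}
    (hδ : IsMIntegralCurveOn δ (thermostatField g o lam) s) (hs : IsOpen s) {t : ℝ} (ht : t ∈ s)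
    {F : Type*} [NormedAddCommGroup F] [NormedSpace ℝ F] {f : TM M → F}
    {f' : Plane × Plane →L[ℝ] F} (hf : HasMFDerivAt (𝓡 2).tangent 𝓘(ℝ, F) f (δ t) f') :
    HasDerivAt (fun t => f (δ t)) (f' (thermostatField g o lam (δ t) : Plane × Plane)) t := by
  have h := (hδ t ht).hasMFDerivAt (hs.mem_nhds ht)
  exact hasDerivAt_of_comp_smulRight (hf.comp t h).hasFDerivAt

lemma eq_of_hasDerivAt_zero {s : Set ℝ} (hs : IsOpenInterval s) {f : ℝ → ℝ}
    (hf : ∀ t ∈ s, HasDerivAt f 0 t) {a b : ℝ} (ha : a ∈ s) (hb : b ∈ s) : f a = f b :=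
  hs.2.convex.is_const_of_fderivWithin_eq_zero (𝕜 := ℝ)
    (fun t ht => (hf t ht).differentiableAt.differentiableWithinAt)
    (fun t ht => by
      rw [fderivWithin_of_isOpen hs.1 ht, ← toSpanSingleton_deriv, (hf t ht).deriv]
      simp) ha hb

/-- Through every unit tangent vector there is an orbit of a smooth thermostat. -/
lemma exists_isOrbit (g : RiemMetric M) (o : SurfaceOrientation M)
    {lam : UnitTangent g → ℝ} (hlam : SmoothOnSM g lam) (u : UnitTangent g) :
    ∃ (s : Set ℝ) (δ : ℝ → TM M), IsOpenInterval s ∧ (0 : ℝ) ∈ s ∧ IsOrbit g o lam s δ ∧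
      δ 0 = u.1 := by
  obtain ⟨δ, h0, hδ⟩ := exists_isMIntegralCurveAt_of_contMDiffAt_boundaryless (t₀ := 0)
    (contMDiffAt_thermostatField g o hlam u.ne_zero)
  obtain ⟨ε, hε, hδ⟩ := isMIntegralCurveAt_iff'.1 hδ
  have hopen : IsOpen (Metric.ball (0 : ℝ) ε) := Metric.isOpen_ball
  have hint : IsOpenInterval (Metric.ball (0 : ℝ) ε) := ⟨hopen, (convex_ball 0 ε).ordConnected⟩
  refine ⟨Metric.ball 0 ε, δ, hint, Metric.mem_ball_self hε,
    ⟨hδ, fun t ht => ?_⟩, h0⟩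
  have hder : ∀ t ∈ Metric.ball (0 : ℝ) ε, HasDerivAt (fun t => normSq g (δ t)) 0 t := by
    intro t ht
    have h := hasDerivAt_comp_integralCurve hδ hopen ht
      (((contMDiff_normSq g).mdifferentiableAt (by simp)).hasMFDerivAt)
    have h' := mfderiv_normSq_thermostatField g o lam (δ t)
    exact h' ▸ h
  have h1 : normSq g (δ 0) = 1 := by
    rw [h0]
    exact u.2
  rw [← h1]
  exact eq_of_hasDerivAt_zero hint hder ht (Metric.mem_ball_self hε)

/-! ### Geodesics in a chart -/

lemma continuous_tangent_proj : Continuous (fun u : TM M => u.1) :=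
  (Bundle.contMDiff_proj (n := ∞) (IB := 𝓡 2) (TangentSpace (𝓡 2) (M := M))).continuous

/-- In any chart, the velocity of a geodesic is the vector component of the orbit. -/
lemma hasDerivAt_chart_base {g : RiemMetric M} {o : SurfaceOrientation M}
    {lam : UnitTangent g → ℝ} {s : Set ℝ} {δ : ℝ → TM M}
    (hδ : IsMIntegralCurveOn δ (thermostatField g o lam) s) (hs : IsOpen s) {t : ℝ} (ht : t ∈ s)
    {x₀ : M} (hx : (δ t).1 ∈ (chartAt Plane x₀).source) :
    HasDerivAt (fun t => extChartAt (𝓡 2) x₀ (δ t).1) (toChart x₀ (δ t).1 (δ t).2) t := by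
  have hf : HasFDerivAt (Prod.fst : Plane × Plane → Plane) (ContinuousLinearMap.fst ℝ Plane Plane)
    (extChartAt (𝓡 2) (δ t).1 (δ t).1, vec (δ t)) := hasFDerivAt_fst
  have hτ := ((contDiffAt_transition (mem_transitionDomain hx)).differentiableAt
    (by simp)).hasFDerivAt
  have hc : ContinuousAt (fun u : TM M => extChartAt (𝓡 2) x₀ u.1) (δ t) :=
    (continuousAt_extChartAt' (I := 𝓡 2) (by rwa [extChartAt_source])).comp
      (f := fun u : TM M => u.1) continuous_tangent_proj.continuousAt
  have h := hasMFDerivAt_of_chart hc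
    (hτ.comp (extChartAt (𝓡 2) (δ t).1 (δ t).1, vec (δ t)) hf) (.of_forall fun z => rfl)
  have h2 := hasDerivAt_comp_integralCurve hδ hs ht h
  rw [thermostatField_eq] at h2
  rw [toChart_eq hx]
  exact h2

/-- The acceleration of a geodesic, in the preferred chart at its position. -/
lemma hasDerivAt_chart_vec {g : RiemMetric M} {o : SurfaceOrientation M}
    {lam : UnitTangent g → ℝ} {s : Set ℝ} {δ : ℝ → TM M}
    (hδ : IsMIntegralCurveOn δ (thermostatField g o lam) s) (hs : IsOpen s) {t : ℝ} (ht : t ∈ s)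
    {u : TM M} (hu : δ t = u) :
    HasDerivAt (fun t => toChart u.1 (δ t).1 (δ t).2)
      (-christoffel g u.1 (extChartAt (𝓡 2) u.1 u.1) (vec u) (vec u)
        + extend g lam u • planeJ g o u.1 (vec u)) t := by
  subst hu
  have hf : HasFDerivAt (Prod.snd : Plane × Plane → Plane) (ContinuousLinearMap.snd ℝ Plane Plane)
    (extChartAt (𝓡 2) (δ t).1 (δ t).1, vec (δ t)) := hasFDerivAt_snd
  have hsrc : ∀ᶠ w : TM M in 𝓝 (δ t), w.1 ∈ (chartAt Plane (δ t).1).source :=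
    continuous_tangent_proj.continuousAt.eventually
      ((chartAt Plane (δ t).1).open_source.mem_nhds (mem_chart_source Plane (δ t).1))
  have hc : ContinuousAt (fun w : TM M => toChart (δ t).1 w.1 w.2) (δ t) := by
    refine (continuousAt_snd.comp (continuousAt_extChartAt (I := (𝓡 2).tangent) (δ t))).congr ?_
    filter_upwards [hsrc] with w hw
    rw [Function.comp_apply, extChartAt_tangent_apply _ _ hw]
  have h := hasMFDerivAt_of_chart hc hf (by
    filter_upwards [eventually_fst_mem_target (δ t).1 (vec (δ t))] with z hz
    exact toChart_ofChart (symm_mem_chart_source hz) z.2)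
  have h2 := hasDerivAt_comp_integralCurve hδ hs ht h
  rw [thermostatField_eq] at h2
  exact h2

lemma planeJ_smul (g : RiemMetric M) (o : SurfaceOrientation M) (x : M) (c : ℝ) (a : Plane) :
    planeJ g o x (c • a) = c • planeJ g o x a := rot_smul g o x c a

lemma symbol_smul_smul (G : Plane → BilinForm) (y a : Plane) (c : ℝ) :
    symbol G y (c • a) (c • a) = (c * c) • symbol G y a a := by
  ext k
  simp only [symbol, lowerSymbol, PiLp.smul_apply, Fin.sum_univ_two, map_smul, smul_apply,
    smul_eq_mul]
  ring

lemma normSq_smul (g : RiemMetric M) (x : M) (v : TangentSpace (𝓡 2) x) (c : ℝ) :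
    normSq g ⟨x, c • v⟩ = c ^ 2 * normSq g ⟨x, v⟩ := by
  simp only [normSq, map_smul, smul_apply, smul_eq_mul]
  ring

/-- The extension of a function on the unit tangent bundle is constant along rays. -/
lemma extend_smul (g : RiemMetric M) (f : UnitTangent g → ℝ) (x : M) (v : TangentSpace (𝓡 2) x)
    {c : ℝ} (hc : 0 < c) : extend g f ⟨x, c • v⟩ = extend g f ⟨x, v⟩ := by
  by_cases hv : v = 0
  · subst hv
    rw [smul_zero]
  · have hcv : c • v ≠ 0 := smul_ne_zero hc.ne' hv
    have hn := normSq_smul g x v c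
    unfold extend
    rw [dif_pos hcv, dif_pos hv]
    congr 1
    unfold normalize
    apply Subtype.ext
    change (⟨x, (√(normSq g ⟨x, c • v⟩))⁻¹ • c • v⟩ : TM M) = ⟨x, (√(normSq g ⟨x, v⟩))⁻¹ • v⟩
    rw [hn, Real.sqrt_mul (sq_nonneg c), Real.sqrt_sq hc.le, smul_smul, mul_inv_rev, mul_assoc,
      inv_mul_cancel₀ hc.ne', mul_one]

/-- If every geodesic of the thermostat of `(g, lam)` is, up to reparametrisation, a geodesic of the
thermostat of `(g', lam')`, then the components normal to `v` of the accelerations of the two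
geodesics in the direction of a unit vector `v` agree up to scale. -/
lemma normal_acceleration_eq {g g' : RiemMetric M} {o : SurfaceOrientation M}
    {lam : UnitTangent g → ℝ} {lam' : UnitTangent g' → ℝ} (hlam : SmoothOnSM g lam)
    (h : GeodesicsReparametriseTo o g lam g' lam') (x : M) (v : Plane)
    (hv : normSq g (⟨x, v⟩ : TM M) = 1) :
    metricInChart g x (extChartAt (𝓡 2) x x) (planeJ g o x v)
        (symbol (metricInChart g' x) (extChartAt (𝓡 2) x x) v v
          - symbol (metricInChart g x) (extChartAt (𝓡 2) x x) v v)
      + extend g lam ⟨x, v⟩ * metricInChart g x (extChartAt (𝓡 2) x x) (planeJ g o x v)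
        (planeJ g o x v)
      = √(normSq g' ⟨x, v⟩) * extend g' lam' ⟨x, v⟩ *
        metricInChart g x (extChartAt (𝓡 2) x x) (planeJ g o x v) (planeJ g' o x v) := by
  obtain ⟨s, δ, hs, h0, hδ, hδ0⟩ := exists_isOrbit g o hlam ⟨⟨x, v⟩, hv⟩
  replace hδ0 : δ 0 = (⟨x, v⟩ : TM M) := hδ0
  obtain ⟨s', φ, ⟨hs', hφ, hφpos, hφim⟩, δ', hδ', hbase⟩ :=
    h s (fun t => (δ t).1) hs ⟨δ, hδ, fun t _ => rfl⟩
  obtain ⟨t₁, ht₁, hφt₁⟩ : (0 : ℝ) ∈ φ '' s' := hφim ▸ h0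
  have hb1 : (δ' t₁).1 = x := by
    rw [hbase t₁ ht₁, Function.comp_apply, hφt₁, hδ0]
  obtain ⟨w, hw⟩ : ∃ w : Plane, δ' t₁ = (⟨x, w⟩ : TM M) := by
    subst hb1
    exact ⟨(δ' t₁).2, rfl⟩
  have hφd : ∀ t ∈ s', HasDerivAt φ (deriv φ t) t := fun t ht =>
    ((hφ.contDiffAt (hs'.1.mem_nhds ht)).differentiableAt (by simp)).hasDerivAt
  have hφd2 : DifferentiableAt ℝ (deriv φ) t₁ :=
    ((hφ.deriv_of_isOpen (m := 1) hs'.1 (by norm_cast)).contDiffAt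
      (hs'.1.mem_nhds ht₁)).differentiableAt (by simp)
  have hmaps : ∀ t ∈ s', φ t ∈ s := fun t ht => hφim ▸ Set.mem_image_of_mem φ ht
  -- near `t₁` the velocity of the reparametrised geodesic is `φ'` times the original velocity
  have hev : ∀ᶠ t in 𝓝 t₁, toChart x (δ' t).1 (δ' t).2
      = deriv φ t • toChart x (δ (φ t)).1 (δ (φ t)).2 := by
    have hc : ContinuousAt (fun t => (δ' t).1) t₁ :=
      continuous_tangent_proj.continuousAt.comp
        ((hδ'.1 t₁ ht₁).hasMFDerivAt (hs'.1.mem_nhds ht₁)).continuousAt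
    have hsrc : ∀ᶠ t in 𝓝 t₁, (δ' t).1 ∈ (chartAt Plane x).source := by
      refine hc.eventually ((chartAt Plane x).open_source.mem_nhds ?_)
      change (δ' t₁).1 ∈ _
      rw [hb1]
      exact mem_chart_source Plane x
    filter_upwards [hsrc, hs'.1.mem_nhds ht₁] with t ht ht'
    have h1 := hasDerivAt_chart_base hδ'.1 hs'.1 ht' ht
    have h2 := hasDerivAt_chart_base hδ.1 hs.1 (hmaps t ht') (x₀ := x)
      (by rw [← Function.comp_apply (f := fun t => (δ t).1), ← hbase t ht']; exact ht)
    have h3 := h2.scomp t (hφd t ht')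
    refine h1.unique (h3.congr_of_eventuallyEq ?_)
    filter_upwards [hs'.1.mem_nhds ht'] with r hr
    exact congrArg _ (hbase r hr)
  have hd := hasDerivAt_chart_vec hδ.1 hs.1 h0 hδ0
  have hd' := hasDerivAt_chart_vec hδ'.1 hs'.1 ht₁ hw
  have hcomp : HasDerivAt (fun t => deriv φ t • toChart x (δ (φ t)).1 (δ (φ t)).2) _ t₁ :=
    hφd2.hasDerivAt.smul
      (HasDerivAt.scomp t₁ (g₁ := fun t => toChart x (δ t).1 (δ t).2) (hφt₁.symm ▸ hd)
        (hφd t₁ ht₁))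
  have hacc := hd'.unique (hcomp.congr_of_eventuallyEq hev)
  have hvel := hev.self_of_nhds
  rw [hφt₁] at hacc hvel
  rw [hδ0] at hacc hvel
  rw [hw] at hvel
  have hvel : w = deriv φ t₁ • v :=
    (toChart_self x w).symm.trans (hvel.trans (congrArg _ (toChart_self x v)))
  have hc := hφpos t₁ ht₁
  set c := deriv φ t₁
  subst hvel
  have hnorm : c ^ 2 * normSq g' (⟨x, v⟩ : TM M) = 1 := by
    have h1 := hδ'.2 t₁ ht₁
    rw [hw] at h1
    exact (normSq_smul g' x v c).symm.trans h1
  -- both orbits consist of unit vectors, which determines the speed of the reparametrisation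
  have hp : √(normSq g' (⟨x, v⟩ : TM M)) = c⁻¹ := by
    rw [Real.sqrt_eq_iff_mul_self_eq_of_pos (inv_pos.2 hc), ← mul_right_inj' (pow_pos hc 2).ne',
      hnorm]
    field_simp
  have hext : extend g' lam' (⟨x, c • v⟩ : TM M) = extend g' lam' ⟨x, v⟩ :=
    extend_smul g' lam' x v hc
  have htv : toChart x x (v : TangentSpace (𝓡 2) x) = v := toChart_self x v
  set y := extChartAt (𝓡 2) x x
  replace hacc : -symbol (metricInChart g' x) y (c • v) (c • v)
      + extend g' lam' (⟨x, c • v⟩ : TM M) • planeJ g' o x (c • v) =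
    c • c • (-symbol (metricInChart g x) y v v + extend g lam (⟨x, v⟩ : TM M) • planeJ g o x v)
      + deriv (deriv φ) t₁ • toChart x x (v : TangentSpace (𝓡 2) x) := hacc
  rw [htv, hext, symbol_smul_smul, planeJ_smul] at hacc
  have hkey := congrArg (metricInChart g x y (planeJ g o x v)) hacc
  have horth : metricInChart g x y (planeJ g o x v) v = 0 := by
    rw [metricInChart_symm]
    exact planeJ_orthogonal g o x v
  -- the component of `hacc` along `J v`: the term with `φ''` is tangential and drops out
  simp only [map_add, map_neg, map_smul, smul_eq_mul, horth] at hkey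
  rw [hp, map_sub]
  have hc0 := hc.ne'
  field_simp
  refine mul_left_cancel₀ hc0 ?_
  linear_combination -hkey

/-! ### Functions on a fibre -/

/-- The restriction to a fibre of a differentiable function on the tangent bundle. -/
lemma hasFDerivAt_fibre {f : TM M → ℝ} {x : M} {v : Plane} {D : Plane × Plane →L[ℝ] ℝ}
    (hf : HasMFDerivAt (𝓡 2).tangent 𝓘(ℝ, ℝ) f (⟨x, v⟩ : TM M) D) :
    HasFDerivAt (fun a : Plane => f (⟨x, a⟩ : TM M))
      (D.comp (ContinuousLinearMap.inr ℝ Plane Plane)) v := by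
  have hi : HasFDerivAt (fun a : Plane => (extChartAt (𝓡 2) x x, a))
      (ContinuousLinearMap.inr ℝ Plane Plane) v := hasFDerivAt_prodMk_right _ v
  have h1 : HasFDerivWithinAt (writtenInExtChartAt (𝓡 2).tangent 𝓘(ℝ, ℝ) (⟨x, v⟩ : TM M) f) D
    (Set.range (𝓡 2).tangent) (extChartAt (𝓡 2).tangent (⟨x, v⟩ : TM M) ⟨x, v⟩) := hf.2
  rw [ModelWithCorners.Boundaryless.range_eq_univ, hasFDerivWithinAt_univ,
    extChartAt_tangent_self] at h1
  have h2 := HasFDerivAt.comp (f := fun a : Plane => (extChartAt (𝓡 2) x x, a)) v h1 hi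
  refine h2.congr_of_eventuallyEq (.of_forall fun a => ?_)
  have h3 : (⟨x, a⟩ : TM M) ∈ (extChartAt (𝓡 2).tangent (⟨x, v⟩ : TM M)).source := by
    rw [extChartAt_source, TangentBundle.mem_chart_source_iff]
    exact mem_chart_source Plane x
  have h4 := (extChartAt (𝓡 2).tangent (⟨x, v⟩ : TM M)).left_inv h3
  rw [extChartAt_tangent_apply _ _ (mem_chart_source Plane x)] at h4
  have h5 : toChart x x (a : TangentSpace (𝓡 2) x) = a := toChart_self x a
  change f _ = f _
  conv_lhs => rw [← h4]
  exact congrArg (fun b : Plane => f ((extChartAt (𝓡 2).tangent (⟨x, v⟩ : TM M)).symm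
    (extChartAt (𝓡 2) x x, b))) h5

lemma extend_self (g : RiemMetric M) (f : UnitTangent g → ℝ) (u : UnitTangent g) :
    extend g f u.1 = f u := by
  unfold extend
  rw [dif_pos u.ne_zero]
  congr 1
  apply Subtype.ext
  obtain ⟨⟨x, v⟩, hu⟩ := u
  change (⟨x, (√(normSq g ⟨x, v⟩))⁻¹ • v⟩ : TM M) = ⟨x, v⟩
  rw [hu, Real.sqrt_one, inv_one, one_smul]

/-- The derivative of a function which is constant along rays. -/
lemma fderiv_of_homogeneous {H : Plane → ℝ} (hH : ∀ a, ∀ c : ℝ, 0 < c → H (c • a) = H a)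
    {v : Plane} {k : ℝ} (hk : 0 < k) (hd : DifferentiableAt ℝ H v)
    (hdk : DifferentiableAt ℝ H (k • v)) :
    (∀ a, fderiv ℝ H (k • v) (k • a) = fderiv ℝ H v a) ∧ fderiv ℝ H v v = 0 := by
  constructor
  · intro a
    have h1 : HasFDerivAt (fun a : Plane => k • a) (k • ContinuousLinearMap.id ℝ Plane) v :=
      (hasFDerivAt_id v).const_smul k
    have h2 := (hdk.hasFDerivAt.comp (f := fun a : Plane => k • a) v h1).congr_of_eventuallyEq
      (f₁ := H) (.of_forall fun a => (hH a k hk).symm)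
    rw [h2.fderiv]
    simp
  · have h1 : HasDerivAt (fun t : ℝ => v + t • v) v 0 := by
      simpa using ((hasDerivAt_id (0 : ℝ)).smul_const v).const_add v
    have hd' : HasFDerivAt H (fderiv ℝ H v) (v + (0 : ℝ) • v) := by
      rw [zero_smul, add_zero]
      exact hd.hasFDerivAt
    have h2 : HasDerivAt (fun t : ℝ => H (v + t • v)) _ 0 := hd'.comp_hasDerivAt (0 : ℝ) h1
    have h3 : (fun t : ℝ => H (v + t • v)) =ᶠ[𝓝 0] fun _ => H v := by
      filter_upwards [lt_mem_nhds (show (-1 : ℝ) < 0 by norm_num)] with t ht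
      rw [← hH v (1 + t) (by linarith), add_smul, one_smul]
    exact h2.unique ((hasDerivAt_const (0 : ℝ) (H v)).congr_of_eventuallyEq h3)

/-! ### Two metrics at a point -/

lemma planeJ_planeJ (g : RiemMetric M) (o : SurfaceOrientation M) (x : M) (a : Plane) :
    planeJ g o x (planeJ g o x a) = -a := rot_rot g o x a

lemma planeJ_add (g : RiemMetric M) (o : SurfaceOrientation M) (x : M) (a b : Plane) :
    planeJ g o x (a + b) = planeJ g o x a + planeJ g o x b := rot_add g o x a b

lemma metricInChart_planeJ_planeJ (g : RiemMetric M) (o : SurfaceOrientation M) (x : M)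
    (a b : Plane) :
    metricInChart g x (extChartAt (𝓡 2) x x) (planeJ g o x a) (planeJ g o x b)
      = metricInChart g x (extChartAt (𝓡 2) x x) a b := by
  rw [metricInChart_self, metricInChart_self]
  exact inner_rot_rot g o x a b

/-- The rotations of two metrics for the same orientation: the component of `J' a` along `J a`. The
two area forms are positive multiples of each other. -/
lemma planeJ_pairing (g g' : RiemMetric M) (o : SurfaceOrientation M) (x : M) (a : Plane) :
    √(gramDet (metricInChart g' x (extChartAt (𝓡 2) x x)) (stdVec 0) (stdVec 1)) *
      metricInChart g x (extChartAt (𝓡 2) x x) (planeJ g o x a) (planeJ g' o x a)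
      = √(gramDet (metricInChart g x (extChartAt (𝓡 2) x x)) (stdVec 0) (stdVec 1)) *
        metricInChart g' x (extChartAt (𝓡 2) x x) a a := by
  rw [← metricInChart_planeJ_planeJ g' o, planeJ_spec g, planeJ_spec g']
  ring

/-! ### The logarithmic density -/

lemma exists_hasFDerivAt_gramDet {G : Plane → BilinForm} {y : Plane}
    (hd : DifferentiableAt ℝ G y) (a v n : Plane) :
    ∃ L : Plane × Plane →L[ℝ] ℝ,
      HasFDerivAt (fun z : Plane × Plane => gramDet (G z.1) v n) L (y, a) ∧
      ∀ b c, L (b, c) = fderiv ℝ G y b v v * G y n n + G y v v * fderiv ℝ G y b n n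
        - 2 * G y v n * fderiv ℝ G y b v n := by
  have hf : HasFDerivAt (Prod.fst : Plane × Plane → Plane) (ContinuousLinearMap.fst ℝ Plane Plane)
    (y, a) := hasFDerivAt_fst
  have hG : HasFDerivAt (fun z : Plane × Plane => G z.1)
    ((fderiv ℝ G y).comp (ContinuousLinearMap.fst ℝ Plane Plane)) (y, a) :=
    hd.hasFDerivAt.comp (y, a) hf
  have h (p q : Plane) : ∃ L : Plane × Plane →L[ℝ] ℝ,
      HasFDerivAt (fun z : Plane × Plane => G z.1 p q) L (y, a) ∧
      ∀ b c, L (b, c) = fderiv ℝ G y b p q :=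
    ⟨_, (hG.clm_apply (hasFDerivAt_const p _)).clm_apply (hasFDerivAt_const q _), by simp⟩
  obtain ⟨L₁, h₁, e₁⟩ := h v v
  obtain ⟨L₂, h₂, e₂⟩ := h n n
  obtain ⟨L₃, h₃, e₃⟩ := h v n
  refine ⟨_, (h₁.mul h₂).sub (h₃.pow 2), fun b c => ?_⟩
  simp [e₁, e₂, e₃]
  ring

/-- The function `log ((p q - r ^ 2) / p ^ (3 / 2))` on the unit tangent bundle. -/
def logDensity (g g' : RiemMetric M) (o : SurfaceOrientation M) (u : UnitTangent g) : ℝ :=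
  Real.log ((pFun g g' u * qFun g g' o u - rFun g g' o u ^ 2) / pFun g g' u ^ (3 / 2 : ℝ))

lemma pFun_pos (g g' : RiemMetric M) (u : UnitTangent g) : 0 < pFun g g' u :=
  g'.pos _ _ u.ne_zero

/-- The function `p q - r ^ 2` is the ratio of the determinants of the two metrics; in particular it
is constant on the fibres. -/
lemma density_eq (g g' : RiemMetric M) (o : SurfaceOrientation M) (u : UnitTangent g) {x₀ : M}
    (hx : u.1.1 ∈ (chartAt Plane x₀).source) {v n : Plane} (hvn : wedge v n ≠ 0) :
    pFun g g' u * qFun g g' o u - rFun g g' o u ^ 2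
      = gramDet (metricInChart g' x₀ (extChartAt (𝓡 2) x₀ u.1.1)) v n
        / gramDet (metricInChart g x₀ (extChartAt (𝓡 2) x₀ u.1.1)) v n := by
  set B := metricInChart g x₀ (extChartAt (𝓡 2) x₀ u.1.1)
  set B' := metricInChart g' x₀ (extChartAt (𝓡 2) x₀ u.1.1)
  have hs : ∀ a b, B a b = B b a := metricInChart_symm g x₀ _
  have hs' : ∀ a b, B' a b = B' b a := metricInChart_symm g' x₀ _
  set a := toChart x₀ u.1.1 u.1.2
  set b := toChart x₀ u.1.1 (rot g o u.1.1 u.1.2)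
  have h1 : pFun g g' u * qFun g g' o u - rFun g g' o u ^ 2 = gramDet B' a b := by
    unfold gramDet pFun qFun rFun
    rw [metricInChart_toChart g' hx, metricInChart_toChart g' hx, metricInChart_toChart g' hx]
  have h2 : gramDet B a b = 1 := by
    unfold gramDet
    have h3 : g.inner u.1.1 u.1.2 u.1.2 = 1 := u.2
    have h4 : B a b = 0 := by
      rw [hs]
      rw [metricInChart_toChart g hx, inner_rot g o hx, wedge]
      ring
    rw [h4, metricInChart_toChart g hx, metricInChart_toChart g hx, inner_rot_rot, h3]
    norm_num
  have hpos := gramDet_std_pos hs (metricInChart_pos g (extChartAt_mem_target hx))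
  rw [gramDet_eq hs] at h2
  rw [h1, gramDet_eq hs', gramDet_eq hs' v n, gramDet_eq hs v n]
  generalize gramDet B (stdVec 0) (stdVec 1) = d at *
  generalize gramDet B' (stdVec 0) (stdVec 1) = d' at *
  field_simp
  linear_combination d' * h2

/-- The homogeneous extension of the logarithmic density, in terms of a fixed chart and of a fixed
pair of vectors of the plane. -/
lemma extend_logDensity (g g' : RiemMetric M) (o : SurfaceOrientation M) {u : TM M} {x₀ : M}
    (hu : u.2 ≠ 0) (hx : u.1 ∈ (chartAt Plane x₀).source) {v n : Plane} (hvn : wedge v n ≠ 0) :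
    extend g (logDensity g g' o) u =
      Real.log (gramDet (metricInChart g' x₀ (extChartAt (𝓡 2) x₀ u.1)) v n)
        - Real.log (gramDet (metricInChart g x₀ (extChartAt (𝓡 2) x₀ u.1)) v n)
        - 3 / 2 * (Real.log (normSq g' u) - Real.log (normSq g u)) := by
  have hmem := extChartAt_mem_target hx
  have hg := normSq_pos g hu
  have hg' := normSq_pos g' hu
  have hd := gramDet_pos_of_wedge (metricInChart_symm g x₀ _) (metricInChart_pos g hmem) hvn
  have hd' := gramDet_pos_of_wedge (metricInChart_symm g' x₀ _) (metricInChart_pos g' hmem) hvn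
  have hp : pFun g g' (normalize g u hu) = normSq g' u / normSq g u := by
    have h := normSq_smul g' u.1 u.2 (√(normSq g u))⁻¹
    rw [inv_pow, Real.sq_sqrt hg.le] at h
    exact h.trans (by rw [div_eq_inv_mul])
  have hp0 := pFun_pos g g' (normalize g u hu)
  have hdens : pFun g g' (normalize g u hu) * qFun g g' o (normalize g u hu)
      - rFun g g' o (normalize g u hu) ^ 2
      = gramDet (metricInChart g' x₀ (extChartAt (𝓡 2) x₀ u.1)) v n
        / gramDet (metricInChart g x₀ (extChartAt (𝓡 2) x₀ u.1)) v n :=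
    density_eq g g' o (normalize g u hu) hx hvn
  unfold extend logDensity
  rw [dif_pos hu, hdens,
    Real.log_div (div_pos hd' hd).ne' (Real.rpow_pos_of_pos hp0 _).ne', Real.log_rpow hp0, hp,
    Real.log_div hg'.ne' hg.ne']
  congr 1
  exact Real.log_div hd'.ne' hd.ne'

/-- The derivative of the logarithmic density, in the preferred chart at the base point. -/
lemma hasMFDerivAt_logDensity (g g' : RiemMetric M) (o : SurfaceOrientation M) (x : M)
    {v n : Plane} (hv : v ≠ 0) (hvn : wedge v n ≠ 0) {G G' : Plane → BilinForm} {y : Plane}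
    (hG : G = metricInChart g x) (hG' : G' = metricInChart g' x) (hy : y = extChartAt (𝓡 2) x x) :
    ∃ L : Plane × Plane →L[ℝ] ℝ,
      HasMFDerivAt (𝓡 2).tangent 𝓘(ℝ, ℝ) (extend g (logDensity g g' o)) (⟨x, v⟩ : TM M) L ∧
      ∀ b c, L (b, c) =
        (gramDet (G' y) v n)⁻¹ * (fderiv ℝ G' y b v v * G' y n n + G' y v v * fderiv ℝ G' y b n n
          - 2 * G' y v n * fderiv ℝ G' y b v n)
        - (gramDet (G y) v n)⁻¹ * (fderiv ℝ G y b v v * G y n n + G y v v * fderiv ℝ G y b n n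
          - 2 * G y v n * fderiv ℝ G y b v n)
        - 3 / 2 * ((G' y v v)⁻¹ * (fderiv ℝ G' y b v v + 2 * G' y v c)
          - (G y v v)⁻¹ * (fderiv ℝ G y b v v + 2 * G y v c)) := by
  have hmem : y ∈ (extChartAt (𝓡 2) x).target := hy ▸ mem_extChartAt_target x
  have hs : ∀ y a b, G y a b = G y b a := hG ▸ metricInChart_symm g x
  have hs' : ∀ y a b, G' y a b = G' y b a := hG' ▸ metricInChart_symm g' x
  have hp : ∀ z ∈ (extChartAt (𝓡 2) x).target, ∀ a, a ≠ 0 → 0 < G z a a :=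
    fun z hz => hG ▸ metricInChart_pos g hz
  have hp' : ∀ z ∈ (extChartAt (𝓡 2) x).target, ∀ a, a ≠ 0 → 0 < G' z a a :=
    fun z hz => hG' ▸ metricInChart_pos g' hz
  have hd : DifferentiableAt ℝ G y :=
    hG ▸ (contDiffAt_metricInChart g hmem).differentiableAt (by simp)
  have hd' : DifferentiableAt ℝ G' y :=
    hG' ▸ (contDiffAt_metricInChart g' hmem).differentiableAt (by simp)
  obtain ⟨L₁, h₁, e₁⟩ := exists_hasFDerivAt_gramDet hd' v v n
  obtain ⟨L₂, h₂, e₂⟩ := exists_hasFDerivAt_gramDet hd v v n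
  obtain ⟨L₃, h₃, e₃⟩ := exists_hasFDerivAt_quadratic (hs' y) hd' v
  obtain ⟨L₄, h₄, e₄⟩ := exists_hasFDerivAt_quadratic (hs y) hd v
  have hlog := ((h₁.log (gramDet_pos_of_wedge (hs' y) (hp' y hmem) hvn).ne').sub
    (h₂.log (gramDet_pos_of_wedge (hs y) (hp y hmem) hvn).ne')).sub
    (((h₃.log (hp' y hmem v hv).ne').sub (h₄.log (hp y hmem v hv).ne')).const_mul (3 / 2))
  have hne : ∀ᶠ z : Plane × Plane in 𝓝 (y, v), z.2 ≠ 0 :=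
    continuousAt_snd.eventually (isOpen_ne.mem_nhds (show v ∈ {a : Plane | a ≠ 0} from hv))
  have htgt : ∀ᶠ z : Plane × Plane in 𝓝 (y, v), z.1 ∈ (extChartAt (𝓡 2) x).target :=
    continuousAt_fst.eventually ((isOpen_extChartAt_target x).mem_nhds hmem)
  have hchart : ∀ z : Plane × Plane, z.1 ∈ (extChartAt (𝓡 2) x).target → z.2 ≠ 0 →
      extend g (logDensity g g' o)
        (⟨(extChartAt (𝓡 2) x).symm z.1, ofChart x _ z.2⟩ : TM M) =
      Real.log (gramDet (G' z.1) v n) - Real.log (gramDet (G z.1) v n)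
        - 3 / 2 * (Real.log (G' z.1 z.2 z.2) - Real.log (G z.1 z.2 z.2)) := by
    intro z hz hz2
    have hsrc := symm_mem_chart_source hz
    have hne : ofChart x ((extChartAt (𝓡 2) x).symm z.1) z.2 ≠ 0 := fun h => hz2 (by
      rw [← toChart_ofChart hsrc z.2, h, map_zero])
    rw [extend_logDensity g g' o (u := ⟨(extChartAt (𝓡 2) x).symm z.1, ofChart x _ z.2⟩) hne hsrc
      hvn, hG, hG', (extChartAt (𝓡 2) x).right_inv hz]
    rfl
  subst hy
  have hcont : ContinuousAt (extend g (logDensity g g' o)) (⟨x, v⟩ : TM M) := by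
    have hext := continuousAt_extChartAt (I := (𝓡 2).tangent) (⟨x, v⟩ : TM M)
    have hval := extChartAt_tangent_self (⟨x, v⟩ : TM M)
    have h1 := ContinuousAt.comp_of_eq hlog.continuousAt hext hval
    refine h1.congr ?_
    have hsrc : ∀ᶠ w : TM M in 𝓝 (⟨x, v⟩ : TM M), w.1 ∈ (chartAt Plane x).source :=
      continuous_tangent_proj.continuousAt.eventually
        ((chartAt Plane x).open_source.mem_nhds (mem_chart_source Plane x))
    filter_upwards [hsrc, (isOpen_ne_zero g).mem_nhds (show (⟨x, v⟩ : TM M).2 ≠ 0 from hv)]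
      with w hw hw2
    rw [extend_logDensity g g' o hw2 hw hvn, Function.comp_apply,
      extChartAt_tangent_apply (⟨x, v⟩ : TM M) w hw, hG, hG']
    change _ - _ * (Real.log (metricInChart g' x _ (toChart x w.1 w.2) (toChart x w.1 w.2))
      - Real.log (metricInChart g x _ (toChart x w.1 w.2) (toChart x w.1 w.2))) = _
    rw [metricInChart_toChart g' hw, metricInChart_toChart g hw]
    rfl
  refine ⟨_, hasMFDerivAt_of_chart hcont hlog ?_, fun b c => ?_⟩
  · filter_upwards [hne, htgt] with z hz hz1
    exact hchart z hz1 hz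
  · simp only [sub_apply, smul_apply, smul_eq_mul, e₁, e₂, e₃, e₄]

/-! ### The derivative of the logarithmic density along a thermostat -/

lemma metricInChart_unit {g : RiemMetric M} (o : SurfaceOrientation M) {x : M} {v : Plane}
    (hv : normSq g (⟨x, v⟩ : TM M) = 1) :
    metricInChart g x (extChartAt (𝓡 2) x x) v v = 1 ∧
    metricInChart g x (extChartAt (𝓡 2) x x) v (planeJ g o x v) = 0 ∧
    metricInChart g x (extChartAt (𝓡 2) x x) (planeJ g o x v) (planeJ g o x v) = 1 := by
  have h1 : metricInChart g x (extChartAt (𝓡 2) x x) v v = 1 := by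
    rw [metricInChart_self]
    exact hv
  exact ⟨h1, planeJ_orthogonal g o x v, by rw [metricInChart_planeJ_planeJ, h1]⟩

/-- The algebraic identity behind the formula for `F log ((p q - r ^ 2) / p ^ (3 / 2))`: in a
`G`-orthonormal basis `v, n`, only the components of the difference of the two Levi-Civita
connections and the value `l` of `λ` enter. -/
lemma logDensity_algebra {G G' : Plane → BilinForm} {y v n : Plane} (l : ℝ)
    (hs : ∀ y a b, G y a b = G y b a) (hs' : ∀ y a b, G' y a b = G' y b a)
    (hp : ∀ a, a ≠ 0 → 0 < G y a a) (hp' : ∀ a, a ≠ 0 → 0 < G' y a a)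
    (hd : DifferentiableAt ℝ G y) (hd' : DifferentiableAt ℝ G' y)
    (hv : G y v v = 1) (hvn : G y v n = 0) (hn : G y n n = 1) :
    (gramDet (G' y) v n)⁻¹ * (fderiv ℝ G' y v v v * G' y n n + G' y v v * fderiv ℝ G' y v n n
          - 2 * G' y v n * fderiv ℝ G' y v v n)
        - (gramDet (G y) v n)⁻¹ * (fderiv ℝ G y v v v * G y n n + G y v v * fderiv ℝ G y v n n
          - 2 * G y v n * fderiv ℝ G y v v n)
        - 3 / 2 * ((G' y v v)⁻¹ * (fderiv ℝ G' y v v v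
            + 2 * G' y v (-symbol G y v v + l • n))
          - (G y v v)⁻¹ * (fderiv ℝ G y v v v + 2 * G y v (-symbol G y v v + l • n)))
      = 2 * G y n (symbol G' y v n - symbol G y v n) - G y v (symbol G' y v v - symbol G y v v)
        - 3 * (G y n (symbol G' y v v - symbol G y v v) + l) * (G' y v n / G' y v v) := by
  have hW := wedge_ne_zero_of_orthonormal (hs y) hv hvn hn
  have hD' := (gramDet_pos_of_wedge (hs' y) hp' hW).ne'
  have hv0 : v ≠ 0 := fun h => by simp [h] at hv
  have hP := (hp' v hv0).ne'
  have e1 := orthonormal_expand (hs y) hv hvn hn (symbol G' y v v)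
  have e2 := orthonormal_expand (hs y) hv hvn hn (symbol G' y v n)
  have e3 := orthonormal_expand (hs y) hv hvn hn (symbol G y v v)
  rw [fderiv_eq_symbol hs' hp' hd' v v v, fderiv_eq_symbol hs' hp' hd' v n n,
    fderiv_eq_symbol hs' hp' hd' v v n, fderiv_eq_symbol hs hp hd v v v,
    fderiv_eq_symbol hs hp hd v n n]
  have hg : gramDet (G y) v n = 1 := by rw [gramDet, hv, hvn, hn]; norm_num
  rw [hg, hv, hvn, hn, hs y (symbol G y v v) v, hs y (symbol G y v n) n,
    hs' y (symbol G' y v v) v, hs' y (symbol G' y v v) n, hs' y (symbol G' y v n) n,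
    hs' y (symbol G' y v n) v]
  have f1 : G' y v (symbol G' y v v)
      = G y v (symbol G' y v v) * G' y v v + G y n (symbol G' y v v) * G' y v n := by
    conv_lhs => rw [e1]
    simp only [map_add, map_smul, smul_eq_mul]
  have f2 : G' y n (symbol G' y v v)
      = G y v (symbol G' y v v) * G' y v n + G y n (symbol G' y v v) * G' y n n := by
    conv_lhs => rw [e1]
    simp only [map_add, map_smul, smul_eq_mul, hs' y n v]
  have f3 : G' y v (symbol G' y v n)
      = G y v (symbol G' y v n) * G' y v v + G y n (symbol G' y v n) * G' y v n := by
    conv_lhs => rw [e2]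
    simp only [map_add, map_smul, smul_eq_mul]
  have f4 : G' y n (symbol G' y v n)
      = G y v (symbol G' y v n) * G' y v n + G y n (symbol G' y v n) * G' y n n := by
    conv_lhs => rw [e2]
    simp only [map_add, map_smul, smul_eq_mul, hs' y n v]
  have f5 : G' y v (symbol G y v v)
      = G y v (symbol G y v v) * G' y v v + G y n (symbol G y v v) * G' y v n := by
    conv_lhs => rw [e3]
    simp only [map_add, map_smul, smul_eq_mul]
  simp only [map_add, map_neg, map_sub, map_smul, smul_eq_mul]
  rw [f1, f2, f3, f4, f5, hvn]
  have hD2 : gramDet (G' y) v n = G' y v v * G' y n n - G' y v n ^ 2 := rfl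
  have key : G' y v v * G' y n n - G' y v n ^ 2 ≠ 0 := hD2 ▸ hD'
  rw [hD2]
  generalize G' y v v = p at *
  generalize G' y v n = r at *
  generalize G' y n n = q at *
  field_simp
  ring

/-- The generator of the thermostat applied to the logarithmic density. -/
lemma derivSM_logDensity (g g' : RiemMetric M) (o : SurfaceOrientation M)
    (lam : UnitTangent g → ℝ) {x : M} {v : Plane} (hv : normSq g (⟨x, v⟩ : TM M) = 1)
    {G G' : Plane → BilinForm} {y n : Plane}
    (hG : G = metricInChart g x) (hG' : G' = metricInChart g' x) (hy : y = extChartAt (𝓡 2) x x)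
    (hn : n = planeJ g o x v) :
    derivSM g (logDensity g g' o) ⟨⟨x, v⟩, hv⟩ (thermostatField g o lam ⟨x, v⟩)
      = 2 * G y n (symbol G' y v n - symbol G y v n) - G y v (symbol G' y v v - symbol G y v v)
        - 3 * (G y n (symbol G' y v v - symbol G y v v) + extend g lam ⟨x, v⟩)
          * (G' y v n / G' y v v) := by
  have hmem := mem_extChartAt_target (I := 𝓡 2) x
  obtain ⟨h1, h2, h3⟩ := metricInChart_unit o hv
  have hv0 : v ≠ 0 := fun h => by simp [h] at h1
  have hW := wedge_ne_zero_of_orthonormal (metricInChart_symm g x _) h1 h2 h3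
  obtain ⟨L, hL, eL⟩ := hasMFDerivAt_logDensity g g' o x hv0 hW rfl rfl rfl
  have hder : derivSM g (logDensity g g' o) ⟨⟨x, v⟩, hv⟩ (thermostatField g o lam ⟨x, v⟩)
      = L (thermostatField g o lam ⟨x, v⟩ : Plane × Plane) := by
    unfold derivSM
    rw [hL.mfderiv]
    rfl
  subst hG hG' hy hn
  rw [hder, thermostatField_eq, ← logDensity_algebra (extend g lam ⟨x, v⟩)
    (metricInChart_symm g x) (metricInChart_symm g' x) (metricInChart_pos g hmem)
    (metricInChart_pos g' hmem) ((contDiffAt_metricInChart g hmem).differentiableAt (by simp))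
    ((contDiffAt_metricInChart g' hmem).differentiableAt (by simp)) h1 h2 h3]
  exact eL _ _

/-- The vertical derivative of a function is the derivative of its extension on the fibre, in the
direction `J v`. -/
lemma derivSM_verticalField {g : RiemMetric M} (o : SurfaceOrientation M) {f : UnitTangent g → ℝ}
    (hf : SmoothOnSM g f) (u : UnitTangent g) :
    derivSM g f u (verticalField g o u.1) =
      fderiv ℝ (fun a : Plane => extend g f (⟨u.1.1, a⟩ : TM M)) (vec u.1)
        (planeJ g o u.1.1 (vec u.1)) := by
  have h := ((hf.contMDiffAt u.ne_zero).mdifferentiableAt (by simp)).hasMFDerivAt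
  rw [(hasFDerivAt_fibre (x := u.1.1) (v := vec u.1) h).fderiv]
  rfl

lemma differentiableAt_extend_fibre {g : RiemMetric M} {f : UnitTangent g → ℝ}
    (hf : SmoothOnSM g f) (x : M) {a : Plane} (ha : a ≠ 0) :
    DifferentiableAt ℝ (fun a : Plane => extend g f (⟨x, a⟩ : TM M)) a :=
  (hasFDerivAt_fibre ((hf.contMDiffAt (u := (⟨x, a⟩ : TM M)) ha).mdifferentiableAt
    (by simp)).hasMFDerivAt).differentiableAt

lemma symbol_combination {G : Plane → BilinForm} {y : Plane}
    (hs : ∀ y a b, G y a b = G y b a) (hd : DifferentiableAt ℝ G y) (v n : Plane) (c s : ℝ) :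
    symbol G y (c • v + s • n) (c • v + s • n)
      = (c * c) • symbol G y v v + (2 * c * s) • symbol G y v n + (s * s) • symbol G y n n := by
  have h : ∀ a, symbol G y a (c • v + s • n) = c • symbol G y v a + s • symbol G y n a := by
    intro a
    rw [symbol_symm hs hd, symbol_add_left, symbol_smul_left, symbol_smul_left]
  rw [symbol_add_left, symbol_smul_left, symbol_smul_left, h, h, symbol_symm hs hd n v]
  module

/-! ### Differentiation along the fibre -/

/-- The identity `normal_acceleration_eq` at the unit vector `c v + s J v`, where `c = cos θ` and
`s = sin θ`, expanded in the orthonormal basis `v, n = J v`. The quotient `κ` of the area densities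
does not depend on the vector. -/
lemma normal_acceleration_circle {g g' : RiemMetric M} {o : SurfaceOrientation M}
    {lam : UnitTangent g → ℝ} {lam' : UnitTangent g' → ℝ} (hlam : SmoothOnSM g lam)
    (h : GeodesicsReparametriseTo o g lam g' lam') {x : M} {v : Plane}
    (hv : normSq g (⟨x, v⟩ : TM M) = 1) {G G' : Plane → BilinForm} {y n : Plane} {κ : ℝ}
    (hG : G = metricInChart g x) (hG' : G' = metricInChart g' x) (hy : y = extChartAt (𝓡 2) x x)
    (hn : n = planeJ g o x v)
    (hκ : κ = √(gramDet (G y) (stdVec 0) (stdVec 1)) / √(gramDet (G' y) (stdVec 0) (stdVec 1)))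
    {c s : ℝ} (hcs : c * c + s * s = 1) :
    c * (c * c * G y n (symbol G' y v v - symbol G y v v)
          + 2 * c * s * G y n (symbol G' y v n - symbol G y v n)
          + s * s * G y n (symbol G' y n n - symbol G y n n))
        - s * (c * c * G y v (symbol G' y v v - symbol G y v v)
          + 2 * c * s * G y v (symbol G' y v n - symbol G y v n)
          + s * s * G y v (symbol G' y n n - symbol G y n n))
        + extend g lam (⟨x, c • v + s • n⟩ : TM M)
      = √(c * c * G' y v v + 2 * c * s * G' y v n + s * s * G' y n n)
        * extend g' lam' (⟨x, c • v + s • n⟩ : TM M)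
        * (κ * (c * c * G' y v v + 2 * c * s * G' y v n + s * s * G' y n n)) := by
  have hmem : y ∈ (extChartAt (𝓡 2) x).target := hy ▸ mem_extChartAt_target x
  have hs : ∀ y a b, G y a b = G y b a := hG ▸ metricInChart_symm g x
  have hs' : ∀ y a b, G' y a b = G' y b a := hG' ▸ metricInChart_symm g' x
  have hd : DifferentiableAt ℝ G y :=
    hG ▸ (contDiffAt_metricInChart g hmem).differentiableAt (by simp)
  have hd' : DifferentiableAt ℝ G' y :=
    hG' ▸ (contDiffAt_metricInChart g' hmem).differentiableAt (by simp)
  have hdet' : 0 < gramDet (G' y) (stdVec 0) (stdVec 1) :=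
    gramDet_std_pos (hs' y) (hG' ▸ metricInChart_pos g' hmem)
  obtain ⟨h1, h2, h3⟩ := metricInChart_unit o hv
  rw [← hn] at h2 h3
  rw [← hG, ← hy] at h1 h2 h3
  have hnorm : G y (c • v + s • n) (c • v + s • n) = 1 := by
    simp only [map_add, map_smul, add_apply, smul_apply, smul_eq_mul, h1, h2, h3, hs y n v]
    linarith
  have hnorm' : G' y (c • v + s • n) (c • v + s • n)
      = c * c * G' y v v + 2 * c * s * G' y v n + s * s * G' y n n := by
    simp only [map_add, map_smul, add_apply, smul_apply, smul_eq_mul, hs' y n v]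
    ring
  have hrot : planeJ g o x (c • v + s • n) = c • n - s • v := by
    rw [planeJ_add, planeJ_smul, planeJ_smul, ← hn, hn, planeJ_planeJ]
    module
  have hw : normSq g (⟨x, c • v + s • n⟩ : TM M) = 1 := by
    rw [← hnorm, hG, hy, metricInChart_self]
    rfl
  have hw' : normSq g' (⟨x, c • v + s • n⟩ : TM M)
      = c * c * G' y v v + 2 * c * s * G' y v n + s * s * G' y n n := by
    rw [← hnorm', hG', hy, metricInChart_self]
    rfl
  have key := normal_acceleration_eq hlam h x (c • v + s • n) hw
  have hpair := planeJ_pairing g g' o x (c • v + s • n)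
  rw [metricInChart_planeJ_planeJ, hw'] at key
  rw [← hG, ← hG', ← hy] at key
  rw [← hG, ← hG', ← hy, hnorm'] at hpair
  have hpair' : G y (planeJ g o x (c • v + s • n)) (planeJ g' o x (c • v + s • n))
      = κ * (c * c * G' y v v + 2 * c * s * G' y v n + s * s * G' y n n) := by
    rw [hκ, div_mul_eq_mul_div, eq_div_iff (Real.sqrt_pos.2 hdet').ne', mul_comm]
    exact hpair
  rw [hpair', hnorm, hrot, symbol_combination hs hd, symbol_combination hs' hd'] at key
  rw [← key]
  simp only [map_add, map_sub, map_smul, sub_apply, smul_apply, smul_eq_mul]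
  ring

/-- The identity of `normal_acceleration_circle` at `θ = 0`, and its derivative there. -/
lemma normal_acceleration_deriv {g g' : RiemMetric M} {o : SurfaceOrientation M}
    {lam : UnitTangent g → ℝ} {lam' : UnitTangent g' → ℝ} (hlam : SmoothOnSM g lam)
    (hlam' : SmoothOnSM g' lam')
    (h : GeodesicsReparametriseTo o g lam g' lam') {x : M} {v : Plane}
    (hv : normSq g (⟨x, v⟩ : TM M) = 1) {G G' : Plane → BilinForm} {y n : Plane} {κ : ℝ}
    (hG : G = metricInChart g x) (hG' : G' = metricInChart g' x) (hy : y = extChartAt (𝓡 2) x x)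
    (hn : n = planeJ g o x v)
    (hκ : κ = √(gramDet (G y) (stdVec 0) (stdVec 1)) / √(gramDet (G' y) (stdVec 0) (stdVec 1))) :
    G y n (symbol G' y v v - symbol G y v v) + extend g lam (⟨x, v⟩ : TM M)
        = κ * extend g' lam' (⟨x, v⟩ : TM M) * √(G' y v v) * G' y v v ∧
    2 * G y n (symbol G' y v n - symbol G y v n) - G y v (symbol G' y v v - symbol G y v v)
        + fderiv ℝ (fun a : Plane => extend g lam (⟨x, a⟩ : TM M)) v n
      = κ * fderiv ℝ (fun a : Plane => extend g' lam' (⟨x, a⟩ : TM M)) v n * √(G' y v v) * G' y v v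
        + 3 * κ * extend g' lam' (⟨x, v⟩ : TM M) * √(G' y v v) * G' y v n := by
  have hmem : y ∈ (extChartAt (𝓡 2) x).target := hy ▸ mem_extChartAt_target x
  have h1 : G y v v = 1 := by
    rw [hG, hy]
    exact (metricInChart_unit o hv).1
  have hv0 : v ≠ 0 := fun h => by simp [h] at h1
  have hp : 0 < G' y v v := hG' ▸ metricInChart_pos g' hmem v hv0
  have hcirc : ∀ {c s : ℝ}, c * c + s * s = 1 → _ := fun {c s} hcs =>
    normal_acceleration_circle hlam h hv hG hG' hy hn hκ hcs
  constructor
  · have h0 := hcirc (c := 1) (s := 0) (by norm_num)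
    simp only [one_smul, zero_smul, add_zero, mul_zero, mul_one, one_mul, zero_mul] at h0
    linear_combination h0
  · have hc : HasDerivAt Real.cos 0 0 := by simpa using Real.hasDerivAt_cos 0
    have hs : HasDerivAt Real.sin 1 0 := by simpa using Real.hasDerivAt_sin 0
    have hcurve : HasDerivAt (fun t => Real.cos t • v + Real.sin t • n) n 0 := by
      have := (hc.smul_const v).add (hs.smul_const n)
      rwa [zero_smul, zero_add, one_smul] at this
    have hval : Real.cos 0 • v + Real.sin 0 • n = v := by simp
    have hcomp : ∀ {H : Plane → ℝ}, DifferentiableAt ℝ H v →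
        HasDerivAt (fun t => H (Real.cos t • v + Real.sin t • n)) (fderiv ℝ H v n) 0 := by
      intro H hH
      have hH' : HasFDerivAt H (fderiv ℝ H v) (Real.cos 0 • v + Real.sin 0 • n) := by
        rw [hval]
        exact hH.hasFDerivAt
      exact hH'.comp_hasDerivAt (0 : ℝ) hcurve
    have hquad : ∀ A B C : ℝ, HasDerivAt (fun t => Real.cos t * Real.cos t * A
        + 2 * Real.cos t * Real.sin t * B + Real.sin t * Real.sin t * C) (2 * B) 0 := by
      intro A B C
      have := (((hc.mul hc).mul_const A).add (((hc.const_mul 2).mul hs).mul_const B)).add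
        ((hs.mul hs).mul_const C)
      convert! this using 1
      simp
    have hL := ((hc.mul (hquad (G y n (symbol G' y v v - symbol G y v v))
      (G y n (symbol G' y v n - symbol G y v n)) (G y n (symbol G' y n n - symbol G y n n)))).sub
      (hs.mul (hquad (G y v (symbol G' y v v - symbol G y v v))
      (G y v (symbol G' y v n - symbol G y v n))
      (G y v (symbol G' y n n - symbol G y n n))))).add
      (hcomp (differentiableAt_extend_fibre hlam x hv0))
    have hP := hquad (G' y v v) (G' y v n) (G' y n n)
    have hR := ((hP.sqrt (by simpa using hp.ne')).mul
      (hcomp (differentiableAt_extend_fibre hlam' x hv0))).mul (hP.const_mul κ)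
    have heq := hL.unique (hR.congr_of_eventuallyEq (.of_forall fun t =>
      hcirc (by nlinarith [Real.sin_sq_add_cos_sq t])))
    simp only [Pi.mul_apply, Real.cos_zero, Real.sin_zero, one_smul, zero_smul, add_zero, mul_zero,
      mul_one, one_mul, zero_mul, zero_add] at heq
    have hsq := Real.mul_self_sqrt hp.le
    have hne := (Real.sqrt_pos.2 hp).ne'
    have hfrac : 2 * G' y v n / (2 * √(G' y v v)) * G' y v v = G' y v n * √(G' y v v) := by
      generalize √(G' y v v) = r at *
      rw [← hsq]
      field_simp
    linear_combination heq + κ * extend g' lam' (⟨x, v⟩ : TM M) * hfrac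

/-! ### The derivative identity and the first integral -/

/-- The identity of `derivSM_identity` at the unit vector `u = (x, v)`, with `v` read as a vector of
the model plane. -/
lemma derivSM_identity_unit {g g' : RiemMetric M} {o : SurfaceOrientation M}
    {lam : UnitTangent g → ℝ} {lam' : UnitTangent g' → ℝ} (hlam : SmoothOnSM g lam)
    (hlam' : SmoothOnSM g' lam') (h : GeodesicsReparametriseTo o g lam g' lam')
    (u : UnitTangent g) (x : M) (v : Plane) (hv : normSq g (⟨x, v⟩ : TM M) = 1)
    (hu : u = ⟨⟨x, v⟩, hv⟩) :
    √(pFun g g' u) *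
        derivSM g' lam' (scaling g g' u) (verticalField g' o (scaling g g' u).1) =
      derivSM g (logDensity g g' o) u (thermostatField g o lam u.1) +
        derivSM g lam u (verticalField g o u.1) := by
  have hmem := mem_extChartAt_target (I := 𝓡 2) x
  obtain ⟨h1, h2, h3⟩ := metricInChart_unit o hv
  have hs := metricInChart_symm g x (extChartAt (𝓡 2) x x)
  have hs' := metricInChart_symm g' x (extChartAt (𝓡 2) x x)
  have hv0 : v ≠ 0 := fun h => by simp [h] at h1
  have hp := metricInChart_pos g' hmem v hv0
  obtain ⟨hzero, hone⟩ := normal_acceleration_deriv hlam hlam' h hv rfl rfl rfl rfl rfl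
  have hpF : pFun g g' u = metricInChart g' x (extChartAt (𝓡 2) x x) v v := by
    subst hu
    exact (metricInChart_self g' x v v).symm
  have hk : 0 < (√(normSq g' (⟨x, v⟩ : TM M)))⁻¹ :=
    inv_pos.2 (Real.sqrt_pos.2 (normSq_pos g' (u := (⟨x, v⟩ : TM M)) hv0))
  -- the derivative of `lam'` at `ℓ u` in the direction of `V'`
  obtain ⟨hhom, hrad⟩ := fderiv_of_homogeneous
    (H := fun a : Plane => extend g' lam' (⟨x, a⟩ : TM M))
    (fun a c hc => extend_smul g' lam' x a hc) hk (differentiableAt_extend_fibre hlam' x hv0)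
    (differentiableAt_extend_fibre hlam' x (smul_ne_zero hk.ne' hv0))
  have hvert : derivSM g' lam' (scaling g g' u) (verticalField g' o (scaling g g' u).1)
      = fderiv ℝ (fun a : Plane => extend g' lam' (⟨x, a⟩ : TM M)) v (planeJ g' o x v) := by
    rw [← hhom, ← planeJ_smul]
    subst hu
    exact derivSM_verticalField o hlam' _
  have hV : derivSM g lam u (verticalField g o u.1)
      = fderiv ℝ (fun a : Plane => extend g lam (⟨x, a⟩ : TM M)) v (planeJ g o x v) := by
    subst hu
    exact derivSM_verticalField o hlam _
  -- the radial component of `J' v` does not contribute, as `lam'` is extended constantly on rays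
  have hJ := orthonormal_expand hs h1 h2 h3 (planeJ g' o x v)
  have hdet' := Real.sqrt_pos.2 (gramDet_std_pos hs' (metricInChart_pos g' hmem))
  have hpair : metricInChart g x (extChartAt (𝓡 2) x x) (planeJ g o x v) (planeJ g' o x v)
      = √(gramDet (metricInChart g x (extChartAt (𝓡 2) x x)) (stdVec 0) (stdVec 1)) /
        √(gramDet (metricInChart g' x (extChartAt (𝓡 2) x x)) (stdVec 0) (stdVec 1))
        * metricInChart g' x (extChartAt (𝓡 2) x x) v v := by
    rw [div_mul_eq_mul_div, eq_div_iff hdet'.ne', mul_comm]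
    exact planeJ_pairing g g' o x v
  have hvert' : fderiv ℝ (fun a : Plane => extend g' lam' (⟨x, a⟩ : TM M)) v (planeJ g' o x v)
      = metricInChart g x (extChartAt (𝓡 2) x x) (planeJ g o x v) (planeJ g' o x v) *
        fderiv ℝ (fun a : Plane => extend g' lam' (⟨x, a⟩ : TM M)) v (planeJ g o x v) := by
    conv_lhs => rw [hJ]
    rw [map_add, map_smul, map_smul, hrad, smul_zero, zero_add, smul_eq_mul]
  rw [hpF, hvert, hvert', hpair, hV]
  subst hu
  refine Eq.trans ?_ (congrArg (· + _) (derivSM_logDensity g g' o lam hv rfl rfl rfl rfl).symm)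
  rw [hzero]
  have hdiv : metricInChart g' x (extChartAt (𝓡 2) x x) v v
      * (metricInChart g' x (extChartAt (𝓡 2) x x) v (planeJ g o x v)
        / metricInChart g' x (extChartAt (𝓡 2) x x) v v)
      = metricInChart g' x (extChartAt (𝓡 2) x x) v (planeJ g o x v) :=
    mul_div_cancel₀ _ hp.ne'
  linear_combination -hone + 3 * (√(gramDet (metricInChart g x (extChartAt (𝓡 2) x x)) (stdVec 0) (stdVec 1)) /
        √(gramDet (metricInChart g' x (extChartAt (𝓡 2) x x)) (stdVec 0) (stdVec 1))
      * extend g' lam' (⟨x, v⟩ : TM M) * √(metricInChart g' x (extChartAt (𝓡 2) x x) v v)) * hdiv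

/-- The identity `√p (V' λ' ∘ ℓ) = F log ((p q - r ^ 2) / p ^ (3 / 2)) + V λ`. It suffices that the
geodesics of `(g, λ)` can be reparametrised to geodesics of `(g', λ')`. -/
lemma derivSM_identity {g g' : RiemMetric M} {o : SurfaceOrientation M}
    {lam : UnitTangent g → ℝ} {lam' : UnitTangent g' → ℝ} (hlam : SmoothOnSM g lam)
    (hlam' : SmoothOnSM g' lam') (h : GeodesicsReparametriseTo o g lam g' lam')
    (u : UnitTangent g) :
    √(pFun g g' u) *
        derivSM g' lam' (scaling g g' u) (verticalField g' o (scaling g g' u).1) =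
      derivSM g (logDensity g g' o) u (thermostatField g o lam u.1) +
        derivSM g lam u (verticalField g o u.1) :=
  derivSM_identity_unit hlam hlam' h u u.1.1 u.1.2 u.2 rfl

lemma extend_zero (g : RiemMetric M) : extend g 0 = fun _ => 0 := by
  funext u
  unfold extend
  split_ifs <;> rfl

lemma smoothOnSM_zero (g : RiemMetric M) : SmoothOnSM g 0 := by
  unfold SmoothOnSM
  rw [extend_zero]
  exact contMDiffOn_const

lemma derivSM_zero (g : RiemMetric M) (u : UnitTangent g)
    (ξ : TangentSpace (𝓡 2).tangent u.1) : derivSM g 0 u ξ = 0 := by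
  unfold derivSM
  rw [extend_zero, mfderiv_const]
  rfl

lemma mdifferentiableAt_logDensity (g g' : RiemMetric M) (o : SurfaceOrientation M)
    (x : M) (v : Plane) (hv : normSq g (⟨x, v⟩ : TM M) = 1) :
    MDifferentiableAt (𝓡 2).tangent 𝓘(ℝ, ℝ) (extend g (logDensity g g' o)) (⟨x, v⟩ : TM M) := by
  obtain ⟨h1, h2, h3⟩ := metricInChart_unit o hv
  have hv0 : v ≠ 0 := fun h => by simp [h] at h1
  have hW := wedge_ne_zero_of_orthonormal (metricInChart_symm g x _) h1 h2 h3
  obtain ⟨L, hL, -⟩ := hasMFDerivAt_logDensity g g' o x hv0 hW rfl rfl rfl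
  exact hL.mdifferentiableAt

/-- If the metrics `g` and `g'` have the same unparametrised geodesics, then `X` annihilates the
logarithmic density. -/
lemma derivSM_logDensity_eq_zero {g g' : RiemMetric M} {o : SurfaceOrientation M}
    (h : GeodesicsReparametriseTo o g 0 g' 0) (u : UnitTangent g) :
    derivSM g (logDensity g g' o) u (thermostatField g o 0 u.1) = 0 := by
  have h2 := derivSM_identity (smoothOnSM_zero g) (smoothOnSM_zero g') h u
  rw [derivSM_zero, derivSM_zero, mul_zero, add_zero] at h2
  exact h2.symm

/-- The logarithmic density is a first integral of the geodesic flow if the metrics have the same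
unparametrised geodesics. -/
lemma isFirstIntegral_logDensity {g g' : RiemMetric M} {o : SurfaceOrientation M}
    (h : GeodesicsReparametriseTo o g 0 g' 0) : IsFirstIntegral g o (logDensity g g' o) := by
  intro s δ hs hδ t₁ t₂ h₁ h₂
  have hder : ∀ t ∈ s, HasDerivAt (fun t => extend g (logDensity g g' o) (δ t)) 0 t := by
    intro t ht
    have h1 := hasDerivAt_comp_integralCurve hδ.1 hs.1 ht
      (mdifferentiableAt_logDensity g g' o (δ t).1 (δ t).2 (hδ.2 t ht)).hasMFDerivAt
    have h2 := derivSM_logDensity_eq_zero h ⟨δ t, hδ.2 t ht⟩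
    exact h1.congr_deriv h2
  exact (extend_self g _ ⟨δ t₁, hδ.2 t₁ h₁⟩).symm.trans
    ((eq_of_hasDerivAt_zero hs hder h₁ h₂).trans (extend_self g _ ⟨δ t₂, hδ.2 t₂ h₂⟩))

/-- The determinant `p q - r ^ 2` is positive, so that the real powers and the logarithm of it do not
take junk values. -/
lemma density_pos (g g' : RiemMetric M) (o : SurfaceOrientation M) (u : UnitTangent g) :
    0 < pFun g g' u * qFun g g' o u - rFun g g' o u ^ 2 := by
  obtain ⟨⟨x, v⟩, hv⟩ := u
  have hmem := mem_extChartAt_target (I := 𝓡 2) x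
  have hW : wedge (stdVec 0) (stdVec 1) ≠ 0 := by simp [wedge]
  rw [density_eq g g' o ⟨⟨x, v⟩, hv⟩ (mem_chart_source Plane x) hW]
  exact div_pos (gramDet_std_pos (metricInChart_symm g' x _) (metricInChart_pos g' hmem))
    (gramDet_std_pos (metricInChart_symm g x _) (metricInChart_pos g hmem))

/-- The function `p / (p q - r ^ 2) ^ (2 / 3)` is a function of the logarithmic density. -/
lemma density_rpow_eq (g g' : RiemMetric M) (o : SurfaceOrientation M) (u : UnitTangent g) :
    pFun g g' u / (pFun g g' u * qFun g g' o u - rFun g g' o u ^ 2) ^ (2 / 3 : ℝ)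
      = Real.exp (-(2 / 3) * logDensity g g' o u) := by
  have hp := pFun_pos g g' u
  have hD := density_pos g g' o u
  unfold logDensity
  rw [Real.log_div hD.ne' (Real.rpow_pos_of_pos hp _).ne', Real.log_rpow hp,
    Real.rpow_def_of_pos hD]
  conv_lhs => rw [← Real.exp_log hp]
  rw [← Real.exp_sub]
  congr 1
  rw [Real.exp_log hp]
  ring

end Thermostat

end

theorem proposition5 {M : Type*} [TopologicalSpace M] [T2Space M] [SecondCountableTopology M]
    [ConnectedSpace M] [ChartedSpace (EuclideanSpace ℝ (Fin 2)) M] [IsManifold (𝓡 2) ∞ M]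
    (o : SurfaceOrientation M) (g g' : RiemMetric M) :
    (∀ (lam : UnitTangent g → ℝ) (lam' : UnitTangent g' → ℝ),
      SmoothOnSM g lam → SmoothOnSM g' lam' →
      SameUnparametrisedGeodesics o g lam g' lam' →
      ∀ u : UnitTangent g,
        Real.sqrt (pFun g g' u) *
            derivSM g' lam' (scaling g g' u) (verticalField g' o (scaling g g' u).1) =
          derivSM g
              (fun w => Real.log ((pFun g g' w * qFun g g' o w - rFun g g' o w ^ 2) /
                pFun g g' w ^ (3 / 2 : ℝ)))
              u (thermostatField g o lam u.1) +
            derivSM g lam u (verticalField g o u.1)) ∧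
    (SameUnparametrisedGeodesics o g 0 g' 0 →
      IsFirstIntegral g o
        (fun w => pFun g g' w /
          (pFun g g' w * qFun g g' o w - rFun g g' o w ^ 2) ^ (2 / 3 : ℝ))) := by
  refine ⟨fun lam lam' hlam hlam' h u => derivSM_identity hlam hlam' h.1 u, fun h => ?_⟩
  intro s δ hs hδ t₁ t₂ h₁ h₂
  exact (density_rpow_eq g g' o ⟨δ t₁, hδ.2 t₁ h₁⟩).trans
    ((congrArg (fun r => Real.exp (-(2 / 3) * r))
      (isFirstIntegral_logDensity h.1 s δ hs hδ t₁ t₂ h₁ h₂)).trans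
      (density_rpow_eq g g' o ⟨δ t₂, hδ.2 t₂ h₂⟩).symm)
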